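/- Let $n\ge 1$, let $\mathbb B_n$ be the open unit ball of $\mathbb C^n$ and let $dv$ be Lebesgue measure on $\mathbb B_n$, normalized so that $v(\mathbb B_n)=1$. Let $1<p<\infty$, $\frac1p+\frac1{p'}=1$, and let $A^p$ be the Bergman space of holomorphic functions in $L^p(\mathbb B_n,dv)$. Put $\langle f,g\rangle=\int_{\mathbb B_n} f\,\overline g\,dv$ and $$K_z(w)=\frac1{(1-\langle w,z\rangle_{\mathbb C^n})^{n+1}},\qquad k_z=(1-|z|^2)^{\frac{n+1}2}K_z,\qquad d\lambda(z)=\frac{dv(z)}{(1-|z|^2)^{n+1}},$$ where $\langle w,z\rangle_{\mathbb C^n}=\sum_i w_i\overline{z_i}$, and let $\|K_z\|$ be the norm of $K_z$ in $A^2$. Let $\varphi_z$ be the Möbius involution of $\mathbb B_n$ interchanging $0$ and $z$, $\rho(z,w)=|\varphi_z(w)|$, $\beta(z,w)=\frac12\log\frac{1+\rho(z,w)}{1-\rho(z,w)}$ the Bergman metric, and $D(z,r)=\{w\in\mathbb B_n:\beta(z,w)\le r\}$. A bounded operator $T$ on $A^p$ is called $p$ weakly localized, $T\in\mathcal A_p(\mathbb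 B_n)$, if (i) there is $0<\delta<\min\{p,p'\}$ with $$\sup_{z\in\mathbb B_n}\int_{\mathbb B_n}|\langle Tk_z,k_w\rangle|\,\frac{\|K_z\|^{1-\frac{2\delta}{p'(n+1)}}}{\|K_w\|^{1-\frac{2\delta}{p'(n+1)}}}\,d\lambda(w)<\infty,\qquad \sup_{z\in\mathbb B_n}\int_{\mathbb B_n}|\langle T^*k_z,k_w\rangle|\,\frac{\|K_z\|^{1-\frac{2\delta}{p(n+1)}}}{\|K_w\|^{1-\frac{2\delta}{p(n+1)}}}\,d\lambda(w)<\infty,$$ where $\langle T^*k_z,k_w\rangle=\langle k_z,Tk_w\rangle$; and (ii) there is $0<\delta<\min\{p,p'\}$ such that the same two suprema, with the integrals taken over $\mathbb B_n\setminus D(z,r)$ instead of $\mathbb B_n$, tend to $0$ as $r\to\infty$. Then the Bergman projection $Pf(z)=\int_{\mathbb B_n}K_w(z)f(w)\,dv(w)$ is a bounded operator from $L^p(\mathbb B_n,dv)$ to $A^p$, and the following holds. Let $T$ be in the closure of $\mathcal A_p(\mathbb B_n)$ in the operator norm of the bounded operators on $A^p$, let $N\in\mathbb N$ and let $\epsilon>0$.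 Then there is $r>0$ such that for every countable covering $\{F_j\}$ of $\mathbb B_n$ by pairwise disjoint Borel subsets of $\mathbb B_n$ for which every point of $\mathbb B_n$ belongs to at most $N$ of the sets $G_j=\{z\in\mathbb B_n:\beta(z,F_j)\le r\}$ (where $\beta(z,F)=\inf_{w\in F}\beta(z,w)$), the series $\sum_j M_{1_{F_j}}TPM_{1_{G_j}}f$ converges unconditionally in $L^p(\mathbb B_n,dv)$ for every $f\in A^p$, its sum defines a bounded operator from $A^p$ to $L^p(\mathbb B_n,dv)$, and $$\Big\|TP-\sum_j M_{1_{F_j}}TPM_{1_{G_j}}\Big\|_{A^p\to L^p(\mathbb B_n,dv)}<\epsilon .$$ Here $M_{1_E}$ is multiplication by the indicator function of $E$. -/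

import Mathlib

open MeasureTheory Filter Topology
open scoped ENNReal

noncomputable section

namespace Bergman

/-- The space `ℂⁿ` with its Euclidean norm. -/
abbrev Cn (n : ℕ) : Type := EuclideanSpace ℂ (Fin n)

/-- The open unit ball of `ℂⁿ`. -/
def unitBall (n : ℕ) : Set (Cn n) := Metric.ball 0 1

/-- The measure `dv`: Lebesgue measure on the unit ball, normalized to have total mass one
(this is the normalization for which `K z w = (1 - ⟨w, z⟩)⁻⁽ⁿ⁺¹⁾` is the reproducing kernel). -/
def vol (n : ℕ) : Measure (Cn n) :=
  (volume (unitBall n))⁻¹ • (volume : Measure (Cn n)).restrict (unitBall n)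

/-- The invariant measure `dλ(z) = dv(z) / (1 - |z|²)ⁿ⁺¹`. -/
def invVol (n : ℕ) : Measure (Cn n) :=
  (vol n).withDensity fun z => ENNReal.ofReal (((1 - ‖z‖ ^ 2) ^ (n + 1))⁻¹)

/-- The Bergman kernel `K_z(w) = (1 - \bar z w)⁻⁽ⁿ⁺¹⁾`; note `inner ℂ z w = ∑ i, conj (z i) * w i`. -/
def K {n : ℕ} (z w : Cn n) : ℂ := ((1 - inner ℂ z w) ^ (n + 1))⁻¹

/-- The normalized reproducing kernel `k_z(w) = (1 - |z|²)^{(n+1)/2} / (1 - \bar z w)ⁿ⁺¹`. -/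
def k {n : ℕ} (z w : Cn n) : ℂ :=
  (((1 - ‖z‖ ^ 2) ^ (((n : ℝ) + 1) / 2) : ℝ) : ℂ) * K z w

/-- The norm `‖K_z‖` in `A²`. -/
def normK {n : ℕ} (z : Cn n) : ℝ := (eLpNorm (K z) 2 (vol n)).toReal

/-- The pairing `⟨f, g⟩ = ∫ f \bar g dv`. -/
def pairing {n : ℕ} (f g : Cn n → ℂ) : ℂ := ∫ x, f x * (starRingEnd ℂ) (g x) ∂(vol n)

/-- The Möbius map `φ_z` of the ball interchanging `0` and `z`:
`φ_z(w) = (z - P_z w - √(1-|z|²) (w - P_z w)) / (1 - ⟨w, z⟩)`, where `P_z` is the orthogonal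
projection onto the span of `z`. -/
def moebius {n : ℕ} (z w : Cn n) : Cn n :=
  (1 - inner ℂ z w)⁻¹ •
    (z - (inner ℂ z w / inner ℂ z z) • z
      - ((Real.sqrt (1 - ‖z‖ ^ 2) : ℝ) : ℂ) • (w - (inner ℂ z w / inner ℂ z z) • z))

/-- The pseudohyperbolic metric. -/
def rho {n : ℕ} (z w : Cn n) : ℝ := ‖moebius z w‖

/-- The Bergman metric. -/
def beta {n : ℕ} (z w : Cn n) : ℝ := 1 / 2 * Real.log ((1 + rho z w) / (1 - rho z w))

/-- The closed hyperbolic ball `D(z, r)`. -/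
def D {n : ℕ} (z : Cn n) (r : ℝ) : Set (Cn n) := {w ∈ unitBall n | beta z w ≤ r}

/-- The distance of `z` to the set `F` in the Bergman metric (infinite when `F` is empty). -/
def distTo {n : ℕ} (F : Set (Cn n)) (z : Cn n) : ℝ≥0∞ := ⨅ w ∈ F, ENNReal.ofReal (beta w z)

/-- The `r`-neighbourhood `{z ∈ B : d(z, F) ≤ r}` of `F` in the Bergman metric. -/
def nhd {n : ℕ} (r : ℝ) (F : Set (Cn n)) : Set (Cn n) :=
  {z ∈ unitBall n | distTo F z ≤ ENNReal.ofReal r}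

/-! Helper facts -/

theorem volume_unitBall_ne_zero (n : ℕ) : volume (unitBall n) ≠ 0 :=
  (Metric.measure_ball_pos _ _ one_pos).ne'

instance instIsFiniteMeasureVol (n : ℕ) : IsFiniteMeasure (vol n) := by
  constructor
  rw [vol, Measure.smul_apply, Measure.restrict_apply_univ, smul_eq_mul]
  exact ENNReal.mul_lt_top (ENNReal.inv_lt_top.2 (volume_unitBall_ne_zero n).bot_lt)
    measure_ball_lt_top

theorem ae_mem_unitBall (n : ℕ) : ∀ᵐ z ∂(vol n), z ∈ unitBall n :=
  Measure.ae_smul_measure (ae_restrict_mem Metric.isOpen_ball.measurableSet) _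

theorem norm_inner_lt_one {n : ℕ} {z w : Cn n} (hz : z ∈ unitBall n) (hw : w ∈ unitBall n) :
    ‖inner ℂ z w‖ < 1 := by
  simp only [unitBall, Metric.mem_ball, dist_zero_right] at hz hw
  calc ‖inner ℂ z w‖ ≤ ‖z‖ * ‖w‖ := norm_inner_le_norm _ _
    _ < 1 := by nlinarith [norm_nonneg z, norm_nonneg w]

theorem one_sub_inner_ne_zero {n : ℕ} {z w : Cn n} (hz : z ∈ unitBall n) (hw : w ∈ unitBall n) :
    (1 - inner ℂ z w : ℂ) ≠ 0 := by
  intro h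
  have h1 := norm_inner_lt_one hz hw
  rw [← sub_eq_zero.1 h] at h1
  simp at h1

theorem norm_sq_moebius_aux {n : ℕ} {z w : Cn n} (hz : z ∈ unitBall n) :
    ‖z - (inner ℂ z w / inner ℂ z z) • z
      - ((Real.sqrt (1 - ‖z‖ ^ 2) : ℝ) : ℂ) • (w - (inner ℂ z w / inner ℂ z z) • z)‖ ^ 2
      = ‖(1 - inner ℂ z w : ℂ)‖ ^ 2 - (1 - ‖z‖ ^ 2) * (1 - ‖w‖ ^ 2) := by
  set t : ℂ := inner ℂ z w with ht
  set c : ℂ := t / inner ℂ z z with hc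
  have hzz : (inner ℂ z z : ℂ) = ((‖z‖ ^ 2 : ℝ) : ℂ) := by
    rw [inner_self_eq_norm_sq_to_K]; push_cast; rfl
  have htc : t = c * ((‖z‖ ^ 2 : ℝ) : ℂ) := by
    rcases eq_or_ne z 0 with h | h
    · simp [ht, h]
    · rw [hc, hzz, div_mul_cancel₀]
      exact_mod_cast pow_ne_zero 2 (norm_ne_zero_iff.2 h)
  have hzq : (inner ℂ z (w - c • z) : ℂ) = 0 := by
    rw [inner_sub_right, inner_smul_right, hzz, ← ht, ← htc, sub_self]
  have h1 : ‖w‖ ^ 2 = ‖w - c • z‖ ^ 2 + ‖c‖ ^ 2 * ‖z‖ ^ 2 := by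
    have h := norm_add_sq (𝕜 := ℂ) (w - c • z) (c • z)
    rw [inner_smul_right, ← inner_conj_symm, hzq, sub_add_cancel, norm_smul] at h
    simp only [map_zero, mul_zero] at h
    rw [h]; ring
  have h2 : z - c • z = (1 - c) • z := by rw [sub_smul, one_smul]
  have hz1 : ‖z‖ < 1 := by simpa [unitBall] using hz
  have hs : (Real.sqrt (1 - ‖z‖ ^ 2)) ^ 2 = 1 - ‖z‖ ^ 2 :=
    Real.sq_sqrt (by nlinarith [norm_nonneg z])
  rw [norm_sub_sq (𝕜 := ℂ), h2, inner_smul_right, inner_smul_left, hzq, norm_smul, norm_smul,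
    Complex.norm_real, Real.norm_eq_abs, mul_pow, mul_pow, sq_abs, hs, h1, htc]
  simp only [mul_zero, map_zero, Complex.sq_norm, Complex.normSq_apply, Complex.sub_re,
    Complex.sub_im, Complex.one_re, Complex.one_im, Complex.re_mul_ofReal, Complex.im_mul_ofReal]
  ring

theorem rho_lt_one {n : ℕ} {z w : Cn n} (hz : z ∈ unitBall n) (hw : w ∈ unitBall n) :
    rho z w < 1 := by
  have h0 := norm_pos_iff.2 (one_sub_inner_ne_zero hz hw)
  have hm := norm_sq_moebius_aux (w := w) hz
  simp only [unitBall, Metric.mem_ball, dist_zero_right] at hz hw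
  have h1 : 0 < (1 - ‖z‖ ^ 2) * (1 - ‖w‖ ^ 2) :=
    mul_pos (by nlinarith [norm_nonneg z]) (by nlinarith [norm_nonneg w])
  rw [rho, moebius, norm_smul, norm_inv, inv_mul_lt_one₀ h0]
  exact lt_of_pow_lt_pow_left₀ 2 h0.le (by linarith)

theorem continuousOn_rho {n : ℕ} {z : Cn n} (hz : z ∈ unitBall n) :
    ContinuousOn (fun w => rho z w) (unitBall n) := by
  unfold rho moebius
  refine (ContinuousOn.smul (ContinuousOn.inv₀ (by fun_prop)
    fun w hw => one_sub_inner_ne_zero hz hw) ?_).norm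
  fun_prop

theorem continuousOn_beta {n : ℕ} {z : Cn n} (hz : z ∈ unitBall n) :
    ContinuousOn (fun w => beta z w) (unitBall n) := by
  unfold beta
  have h := continuousOn_rho hz
  refine continuousOn_const.mul (ContinuousOn.log (ContinuousOn.div (continuousOn_const.add h)
    (continuousOn_const.sub h) fun w hw => ?_) fun w hw => ?_)
  · exact (sub_pos.2 (rho_lt_one hz hw)).ne'
  · exact (div_pos (add_pos_of_pos_of_nonneg one_pos (norm_nonneg _))
      (sub_pos.2 (rho_lt_one hz hw))).ne'

theorem measurableSet_nhd {n : ℕ} (r : ℝ) {F : Set (Cn n)} (hF : F ⊆ unitBall n) :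
    MeasurableSet (nhd r F) := by
  have hB : IsOpen (unitBall n) := Metric.isOpen_ball
  have hO : ∀ a : ℝ≥0∞, IsOpen {z ∈ unitBall n | distTo F z < a} := by
    intro a
    have : {z ∈ unitBall n | distTo F z < a}
        = ⋃ w ∈ F, unitBall n ∩ (fun z => ENNReal.ofReal (beta w z)) ⁻¹' Set.Iio a := by
      ext z
      simp only [distTo, iInf_lt_iff, Set.mem_ofPred_eq, Set.mem_iUnion, Set.mem_inter_iff,
        Set.mem_preimage, Set.mem_Iio, exists_prop]
      constructor
      · rintro ⟨h1, w, h2, h3⟩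
        exact ⟨w, h2, h1, h3⟩
      · rintro ⟨w, h2, h1, h3⟩
        exact ⟨h1, w, h2, h3⟩
    rw [this]
    refine isOpen_biUnion fun w hw => ?_
    exact (ENNReal.continuous_ofReal.comp_continuousOn (continuousOn_beta (hF hw))).isOpen_inter_preimage
      hB isOpen_Iio
  have : nhd r F = ⋂ m : ℕ, {z ∈ unitBall n | distTo F z < ENNReal.ofReal r + ((m : ℝ≥0∞) + 1)⁻¹} := by
    ext z
    simp only [nhd, Set.mem_ofPred_eq, Set.mem_iInter]
    constructor
    · rintro ⟨h1, h2⟩ m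
      refine ⟨h1, h2.trans_lt (ENNReal.lt_add_right ENNReal.ofReal_ne_top ?_)⟩
      exact ENNReal.inv_ne_zero.2 (by simp)
    · intro h
      refine ⟨(h 0).1, ENNReal.le_of_forall_pos_le_add fun ε hε _ => ?_⟩
      obtain ⟨m, hm⟩ := ENNReal.exists_inv_nat_lt (a := (ε : ℝ≥0∞)) (by simpa using hε.ne')
      refine (h m).2.le.trans (add_le_add le_rfl (le_trans ?_ hm.le))
      exact ENNReal.inv_le_inv.2 le_self_add
  rw [this]
  exact MeasurableSet.iInter fun m => (hO _).measurableSet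

/-! The Bergman space and the operators on it -/

/-- The Lebesgue space `Lᵖ(B, dv)`. -/
abbrev LpBall (n : ℕ) (p : ℝ≥0∞) := Lp ℂ p (vol n)

/-- The Bergman space `Aᵖ`, as the subspace of the (classes of) functions in `Lᵖ(B, dv)` that are
holomorphic on the ball. -/
def bergmanSpace (n : ℕ) (p : ℝ≥0∞) : Submodule ℂ (LpBall n p) where
  carrier := {f | ∃ g : Cn n → ℂ, DifferentiableOn ℂ g (unitBall n) ∧ f =ᵐ[vol n] g}
  add_mem' := by
    rintro f₁ f₂ ⟨g₁, h₁, e₁⟩ ⟨g₂, h₂, e₂⟩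
    exact ⟨g₁ + g₂, h₁.add h₂, (Lp.coeFn_add f₁ f₂).trans (e₁.add e₂)⟩
  zero_mem' := ⟨0, differentiableOn_const 0, Lp.coeFn_zero _ _ _⟩
  smul_mem' := by
    rintro c f ⟨g, h, e⟩
    exact ⟨c • g, h.const_smul c, (Lp.coeFn_smul c f).trans (e.const_smul c)⟩

theorem differentiableOn_k {n : ℕ} {z : Cn n} (hz : z ∈ unitBall n) :
    DifferentiableOn ℂ (k z) (unitBall n) := by
  unfold k K
  have h : DifferentiableOn ℂ (fun w : Cn n => (1 - inner ℂ z w : ℂ)) (unitBall n) :=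
    (differentiableOn_const 1).sub (innerSL ℂ z).differentiable.differentiableOn
  exact ((h.pow (n + 1)).inv fun w hw => pow_ne_zero _ (one_sub_inner_ne_zero hz hw)).const_mul _

theorem memLp_k {n : ℕ} (p : ℝ≥0∞) {z : Cn n} (hz : z ∈ unitBall n) : MemLp (k z) p (vol n) := by
  refine MemLp.of_bound ?_ (‖(((1 - ‖z‖ ^ 2) ^ (((n : ℝ) + 1) / 2) : ℝ) : ℂ)‖
    * ((1 - ‖z‖) ^ (n + 1))⁻¹) ?_
  · exact ((differentiableOn_k hz).continuousOn.aestronglyMeasurable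
      Metric.isOpen_ball.measurableSet).smul_measure _
  · filter_upwards [ae_mem_unitBall n] with w hw
    simp only [unitBall, Metric.mem_ball, dist_zero_right] at hz hw
    have h1 : 1 - ‖z‖ ≤ ‖(1 - inner ℂ z w : ℂ)‖ := by
      have h2 : ‖(inner ℂ z w : ℂ)‖ ≤ ‖z‖ := (norm_inner_le_norm z w).trans
        (mul_le_of_le_one_right (norm_nonneg z) hw.le)
      have h3 := norm_sub_norm_le (1 : ℂ) (inner ℂ z w)
      rw [norm_one] at h3
      linarith
    rw [k, K, norm_mul, norm_inv, norm_pow]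
    have h4 : 0 < 1 - ‖z‖ := sub_pos.2 hz
    gcongr

/-- The normalized kernel `k_z` as an element of `Aᵖ`, for `z` in the ball
(and, as a convention without effect, zero for `z` outside of the ball). -/
def kernel (n : ℕ) (p : ℝ≥0∞) (z : Cn n) : bergmanSpace n p :=
  open Classical in
  if hz : z ∈ unitBall n then
    ⟨(memLp_k p hz).toLp (k z), k z, differentiableOn_k hz, (memLp_k p hz).coeFn_toLp⟩
  else 0

section Localized

variable {n : ℕ} {p : ℝ≥0∞} [Fact (1 ≤ p)]

/-- The number `⟨T k_z, k_w⟩`. -/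
def entry (T : bergmanSpace n p →L[ℂ] bergmanSpace n p) (z w : Cn n) : ℂ :=
  pairing (T (kernel n p z) : LpBall n p) (k w)

/-- The number `⟨T* k_z, k_w⟩ = ⟨k_z, T k_w⟩`, where `T*` is the adjoint of `T` with respect to
the pairing `⟨f, g⟩ = ∫ f \bar g dv` of `Aᵖ` and its dual. -/
def adjEntry (T : bergmanSpace n p →L[ℂ] bergmanSpace n p) (z w : Cn n) : ℂ :=
  pairing (k z) (T (kernel n p w) : LpBall n p)

/-- `∫_E |M(z, w)| ‖K_z‖ᵃ / ‖K_w‖ᵃ dλ(w)`. -/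
def schurInt (M : Cn n → Cn n → ℂ) (a : ℝ) (z : Cn n) (E : Set (Cn n)) : ℝ≥0∞ :=
  ∫⁻ w in E, ENNReal.ofReal (‖M z w‖ * (normK z ^ a / normK w ^ a)) ∂(invVol n)

/-- The exponent `1 - 2δ / (q (n + 1))`. -/
def expo (n : ℕ) (q δ : ℝ) : ℝ := 1 - 2 * δ / (q * (n + 1))

/-- `p`-weakly localized operators on `Aᵖ`; here `p.toReal.conjExponent` is the exponent `p'`
with `1/p + 1/p' = 1`. -/
structure IsWeaklyLocalized (T : bergmanSpace n p →L[ℂ] bergmanSpace n p) : Prop where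
  bounded : ∃ δ : ℝ, 0 < δ ∧ δ < min p.toReal p.toReal.conjExponent ∧
    (⨆ z ∈ unitBall n,
      schurInt (entry T) (expo n p.toReal.conjExponent δ) z (unitBall n)) < ⊤ ∧
    (⨆ z ∈ unitBall n,
      schurInt (adjEntry T) (expo n p.toReal δ) z (unitBall n)) < ⊤
  vanishing : ∃ δ : ℝ, 0 < δ ∧ δ < min p.toReal p.toReal.conjExponent ∧
    Tendsto (fun r : ℝ => ⨆ z ∈ unitBall n,
      schurInt (entry T) (expo n p.toReal.conjExponent δ) z (unitBall n \ D z r)) atTop (𝓝 0) ∧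
    Tendsto (fun r : ℝ => ⨆ z ∈ unitBall n,
      schurInt (adjEntry T) (expo n p.toReal δ) z (unitBall n \ D z r)) atTop (𝓝 0)

/-- The class of the `p`-weakly localized operators, inside the bounded operators on `Aᵖ`. -/
def weaklyLocalized (n : ℕ) (p : ℝ≥0∞) [Fact (1 ≤ p)] :
    Set (bergmanSpace n p →L[ℂ] bergmanSpace n p) :=
  {T | IsWeaklyLocalized T}

/-- `P` is the Bergman projection, i.e. the bounded operator from `Lᵖ(B, dv)` to `Aᵖ` given by
`P f (z) = ∫ K_w(z) f(w) dv(w)`. -/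
def IsBergmanProjection (P : LpBall n p →L[ℂ] bergmanSpace n p) : Prop :=
  ∀ f : LpBall n p, (P f : LpBall n p) =ᵐ[vol n] fun z => ∫ w, K w z * f w ∂(vol n)

/-- The operator `M_{1_E}` of multiplication by the indicator function of `E` on `Lᵖ(B, dv)`. -/
def mulInd (E : Set (Cn n)) (hE : MeasurableSet E) : LpBall n p →L[ℂ] LpBall n p :=
  LinearMap.mkContinuous
    { toFun := fun f => ((Lp.memLp f).indicator hE).toLp (E.indicator f)
      map_add' := fun f g => by
        rw [← MemLp.toLp_add]
        refine MemLp.toLp_congr _ _ ?_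
        filter_upwards [Lp.coeFn_add f g] with x hx
        rw [Pi.add_apply] at hx ⊢
        by_cases h : x ∈ E <;> simp only [h, Set.indicator_of_mem, Set.indicator_of_notMem,
          not_false_eq_true, hx, add_zero]
      map_smul' := fun c f => by
        rw [RingHom.id_apply, ← MemLp.toLp_const_smul]
        refine MemLp.toLp_congr _ _ ?_
        filter_upwards [Lp.coeFn_smul c f] with x hx
        rw [Pi.smul_apply] at hx ⊢
        by_cases h : x ∈ E <;> simp only [h, Set.indicator_of_mem, Set.indicator_of_notMem,
          not_false_eq_true, hx, smul_zero] }
    1 (fun f => by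
      rw [one_mul, LinearMap.coe_mk, AddHom.coe_mk, Lp.norm_toLp, Lp.norm_def]
      exact ENNReal.toReal_mono (Lp.eLpNorm_ne_top f) (eLpNorm_indicator_le _))

end Localized

/-- Coverings `{F_j}` of the ball by disjoint Borel sets such that every point of the ball belongs
to at most `N` of the `r`-neighbourhoods `G_j = {z ∈ B : d(z, F_j) ≤ r}`. Finite families
are included by letting all but finitely many of the `F_j` be empty (then `G_j` is empty). -/
structure IsBorelCovering (n N : ℕ) (r : ℝ) (F : ℕ → Set (Cn n)) : Prop where
  measurable : ∀ j, MeasurableSet (F j)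
  disjoint : Pairwise fun i j => Disjoint (F i) (F j)
  cover : ⋃ j, F j = unitBall n
  multiplicity : ∀ z ∈ unitBall n, {j | z ∈ nhd r (F j)}.encard ≤ N

theorem IsBorelCovering.subset {n N : ℕ} {r : ℝ} {F : ℕ → Set (Cn n)}
    (h : IsBorelCovering n N r F) (j : ℕ) : F j ⊆ unitBall n :=
  h.cover ▸ Set.subset_iUnion F j

end Bergman

end

noncomputable section

namespace Bergman

/-! On `F j` only the term with index `j` of the series is visible, since the `F j` are disjoint.
There `TP f - S f` is `TP` applied to `f` cut off to the complement of `G j`. Writing `TP f(z) = ∫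
(T K_w)(z) f(w) dv(w)`, only pairs `(z, w)` with `β(z, w) > r` contribute. Hence for every covering
the error is dominated pointwise by the same positive integral operator, with kernel `farKernel T
r`.

For weakly localized `T` this operator has small norm on `Lᵖ` when `r` is large. After the powers of
`1 - |z|²` in `k_z`, `‖K_z‖` and `dλ` are collected (`schurInt_eq`), condition (ii) consists of the
two hypotheses of the Schur test with weight `(1 - |z|²)^(-δ/(p p'))`. The bound for `⟨T k_z, k_w⟩`
integrates out one variable of the kernel, the bound for the adjoint the other. The integral formula
is proved for `f` vanishing near the sphere, where `w ↦ f(w) K_w` is Bochner integrable; density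
gives the estimate for all `f`.

For `T` in the closure, take a weakly localized `T'` near `T`. The block sum is linear in the
operator and costs at most a factor `N^(1/p)`: outputs on disjoint sets add in `p`-th powers, and
the inputs overlap at most `N` times. So replacing `T` by `T'` changes both `TP` and its block sum
by a small amount, uniformly in the covering.

Boundedness of `P` is the same Schur test, fed with the Forelli-Rudin estimate for `|K_w(z)|`. The
reproducing property comes from the mean value property at the origin, transported by the Möbius
involutions. -/

/-! ### Identities for the Möbius involutions -/

theorem one_sub_norm_sq_pos {n : ℕ} {z : Cn n} (hz : z ∈ unitBall n) : 0 < 1 - ‖z‖ ^ 2 := by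
  simp only [unitBall, Metric.mem_ball, dist_zero_right] at hz
  nlinarith [norm_nonneg z]

theorem inner_self_eq_ofReal {n : ℕ} (z : Cn n) : (inner ℂ z z : ℂ) = ((‖z‖ ^ 2 : ℝ) : ℂ) := by
  rw [inner_self_eq_norm_sq_to_K]; push_cast; rfl

theorem inner_div_mul_inner_self {n : ℕ} (z w : Cn n) :
    inner ℂ z w / inner ℂ z z * (inner ℂ z z : ℂ) = inner ℂ z w := by
  rcases eq_or_ne z 0 with h | h
  · simp [h]
  · exact div_mul_cancel₀ _ (inner_self_ne_zero.2 h)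

theorem inner_moebius {n : ℕ} (z w : Cn n) :
    inner ℂ z (moebius z w) = (1 - inner ℂ z w : ℂ)⁻¹ * (inner ℂ z z - inner ℂ z w) := by
  unfold moebius
  simp only [inner_smul_right, inner_sub_right, inner_div_mul_inner_self]
  ring

theorem one_sub_inner_moebius {n : ℕ} {z w : Cn n} (hz : z ∈ unitBall n) (hw : w ∈ unitBall n) :
    1 - inner ℂ z (moebius z w) = ((1 - ‖z‖ ^ 2 : ℝ) : ℂ) / (1 - inner ℂ z w) := by
  have h := one_sub_inner_ne_zero hz hw
  rw [inner_moebius, inner_self_eq_ofReal]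
  field_simp
  push_cast
  ring

theorem one_sub_norm_sq_moebius {n : ℕ} {z w : Cn n} (hz : z ∈ unitBall n) (hw : w ∈ unitBall n) :
    1 - ‖moebius z w‖ ^ 2 = (1 - ‖z‖ ^ 2) * (1 - ‖w‖ ^ 2) / ‖(1 - inner ℂ z w : ℂ)‖ ^ 2 := by
  have h := norm_pos_iff.2 (one_sub_inner_ne_zero hz hw)
  rw [moebius, norm_smul, mul_pow, norm_sq_moebius_aux hz, norm_inv]
  field_simp
  ring

theorem moebius_mem {n : ℕ} {z w : Cn n} (hz : z ∈ unitBall n) (hw : w ∈ unitBall n) :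
    moebius z w ∈ unitBall n := by
  have := rho_lt_one hz hw
  simpa [unitBall, rho] using this

theorem moebius_zero_right {n : ℕ} (z : Cn n) : moebius z 0 = z := by
  simp [moebius]

theorem moebius_moebius {n : ℕ} {z w : Cn n} (hz : z ∈ unitBall n) (hw : w ∈ unitBall n) :
    moebius z (moebius z w) = w := by
  have ha := one_sub_inner_ne_zero hz hw
  have hs := one_sub_norm_sq_pos hz
  have hsC : ((1 - ‖z‖ ^ 2 : ℝ) : ℂ) ≠ 0 := by exact_mod_cast hs.ne'
  -- The projection onto the span of `z` degenerates at `z = 0`, where the map is `w ↦ -w`.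
  -- Otherwise the coefficients of `z` and `w` are compared, using only `σ² = 1 - |z|²`.
  rcases eq_or_ne z 0 with h0 | h0
  · subst h0; simp [moebius]
  have hN : ((‖z‖ ^ 2 : ℝ) : ℂ) ≠ 0 := by
    exact_mod_cast pow_ne_zero 2 (norm_ne_zero_iff.2 h0)
  have hσ : ((Real.sqrt (1 - ‖z‖ ^ 2) : ℝ) : ℂ) * ((Real.sqrt (1 - ‖z‖ ^ 2) : ℝ) : ℂ)
      = 1 - ((‖z‖ ^ 2 : ℝ) : ℂ) := by
    rw [← Complex.ofReal_mul, Real.mul_self_sqrt hs.le]; push_cast; ring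
  have h1 := one_sub_inner_moebius hz hw
  conv_lhs => rw [moebius]
  rw [h1, inner_moebius, moebius, inner_self_eq_ofReal]
  set a : ℂ := inner ℂ z w
  rw [show ((1 - ‖z‖ ^ 2 : ℝ) : ℂ) = 1 - ((‖z‖ ^ 2 : ℝ) : ℂ) by push_cast; rfl] at hsC ⊢
  set N : ℂ := ((‖z‖ ^ 2 : ℝ) : ℂ)
  set σ : ℂ := ((Real.sqrt (1 - ‖z‖ ^ 2) : ℝ) : ℂ)
  match_scalars
  · field_simp
    linear_combination (-a) * hσ
  · field_simp
    linear_combination hσ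

/-! ### Derivative, Jacobian and change of variables for the Möbius maps -/

/-- The complex derivative of the Möbius map `moebius z` at `w`. -/
def moebiusDeriv {n : ℕ} (z w : Cn n) : Cn n →L[ℂ] Cn n :=
  (-((1 - inner ℂ z w : ℂ)⁻¹ * ((Real.sqrt (1 - ‖z‖ ^ 2) : ℝ) : ℂ))) •
    (ContinuousLinearMap.id ℂ (Cn n) + (innerSL ℂ z).smulRight
      (((1 - ((Real.sqrt (1 - ‖z‖ ^ 2) : ℝ) : ℂ)) /
          (((Real.sqrt (1 - ‖z‖ ^ 2) : ℝ) : ℂ) * inner ℂ z z)) • z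
        - ((Real.sqrt (1 - ‖z‖ ^ 2) : ℝ) : ℂ)⁻¹ • moebius z w))

theorem sqrt_ne_zero_of_mem {n : ℕ} {z : Cn n} (hz : z ∈ unitBall n) :
    ((Real.sqrt (1 - ‖z‖ ^ 2) : ℝ) : ℂ) ≠ 0 := by
  exact_mod_cast (Real.sqrt_pos.2 (one_sub_norm_sq_pos hz)).ne'

theorem hasFDerivAt_moebius {n : ℕ} {z w : Cn n} (hz : z ∈ unitBall n) (hw : w ∈ unitBall n) :
    HasFDerivAt (moebius z) (moebiusDeriv z w) w := by
  have ha := one_sub_inner_ne_zero hz hw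
  have hσ := sqrt_ne_zero_of_mem hz
  have hI : HasFDerivAt (fun w : Cn n => (inner ℂ z w : ℂ)) (innerSL ℂ z) w :=
    (innerSL ℂ z).hasFDerivAt
  have h1 : HasFDerivAt (fun w : Cn n => (1 - inner ℂ z w : ℂ)) (-innerSL ℂ z) w := by
    exact hI.const_sub 1
  have h2 := (hasDerivAt_inv ha).comp_hasFDerivAt w h1
  have h3 : HasFDerivAt (fun w : Cn n => (inner ℂ z w / inner ℂ z z : ℂ) • z)
      (((inner ℂ z z : ℂ)⁻¹ • innerSL ℂ z).smulRight z) w := by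
    simp only [div_eq_inv_mul]
    exact (hI.const_mul _).smul_const z
  have h4 := (h3.const_sub z).sub (((hasFDerivAt_id w).sub h3).const_smul
    ((Real.sqrt (1 - ‖z‖ ^ 2) : ℝ) : ℂ))
  have h5 := h2.smul h4
  refine h5.congr_fderiv ?_
  ext1 h
  simp only [moebiusDeriv, moebius, Function.comp_apply, add_apply, smul_apply, sub_apply,
    neg_apply, ContinuousLinearMap.smulRight_apply, ContinuousLinearMap.id_apply,
    innerSL_apply_apply, smul_eq_mul, id_eq, Pi.sub_apply, Pi.smul_apply]
  -- Division by `⟨z, z⟩` is harmless at `z = 0`: the coefficient has the factor `1 - σ`, which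
  -- vanishes there.
  have hσ2 : ((Real.sqrt (1 - ‖z‖ ^ 2) : ℝ) : ℂ) = 1 ∨ (inner ℂ z z : ℂ) ≠ 0 := by
    rcases eq_or_ne z 0 with h0 | h0
    · left; simp [h0]
    · exact Or.inr (inner_self_ne_zero.2 h0)
  generalize (inner ℂ z w : ℂ) = a at *
  generalize (inner ℂ z h : ℂ) = b at *
  generalize (inner ℂ z z : ℂ) = N at *
  generalize ((Real.sqrt (1 - ‖z‖ ^ 2) : ℝ) : ℂ) = σ at *
  rcases hσ2 with rfl | hN
  · match_scalars <;> (simp; try field_simp)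
  · match_scalars <;> field_simp
    ring

/-- The derivative is a scalar times a transvection `h ↦ h + ⟨h, z⟩ v`, whose determinant is `1 +
⟨v, z⟩`. The real determinant is the squared modulus of the complex one. -/
theorem det_moebiusDeriv {n : ℕ} {z w : Cn n} (hz : z ∈ unitBall n) (hw : w ∈ unitBall n) :
    ((moebiusDeriv z w).restrictScalars ℝ).det
      = ((1 - ‖z‖ ^ 2) / ‖(1 - inner ℂ z w : ℂ)‖ ^ 2) ^ (n + 1) := by
  have ha := one_sub_inner_ne_zero hz hw
  have hσ := sqrt_ne_zero_of_mem hz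
  have hs := one_sub_norm_sq_pos hz
  set v : Cn n := ((1 - ((Real.sqrt (1 - ‖z‖ ^ 2) : ℝ) : ℂ)) /
          (((Real.sqrt (1 - ‖z‖ ^ 2) : ℝ) : ℂ) * inner ℂ z z)) • z
        - ((Real.sqrt (1 - ‖z‖ ^ 2) : ℝ) : ℂ)⁻¹ • moebius z w with hv
  have hinner : 1 + inner ℂ z v = ((Real.sqrt (1 - ‖z‖ ^ 2) : ℝ) : ℂ) / (1 - inner ℂ z w) := by
    have h1 := one_sub_inner_moebius hz hw
    have hσσ : ((Real.sqrt (1 - ‖z‖ ^ 2) : ℝ) : ℂ) * ((Real.sqrt (1 - ‖z‖ ^ 2) : ℝ) : ℂ)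
        = ((1 - ‖z‖ ^ 2 : ℝ) : ℂ) := by
      rw [← Complex.ofReal_mul, Real.mul_self_sqrt hs.le]
    have hc : (1 - ((Real.sqrt (1 - ‖z‖ ^ 2) : ℝ) : ℂ)) /
          (((Real.sqrt (1 - ‖z‖ ^ 2) : ℝ) : ℂ) * inner ℂ z z) * (inner ℂ z z : ℂ)
          = (1 - ((Real.sqrt (1 - ‖z‖ ^ 2) : ℝ) : ℂ)) / ((Real.sqrt (1 - ‖z‖ ^ 2) : ℝ) : ℂ) := by
      rcases eq_or_ne z 0 with h0 | h0
      · simp [h0]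
      · have := (inner_self_ne_zero (𝕜 := ℂ)).2 h0
        field_simp
    rw [hv, inner_sub_right, inner_smul_right, inner_smul_right, hc,
      show (inner ℂ z (moebius z w) : ℂ) = 1 - (1 - inner ℂ z (moebius z w)) by ring, h1, ← hσσ]
    field_simp
    ring
  have hlin : ((moebiusDeriv z w : Cn n →L[ℂ] Cn n) : Cn n →ₗ[ℂ] Cn n)
      = (-((1 - inner ℂ z w : ℂ)⁻¹ * ((Real.sqrt (1 - ‖z‖ ^ 2) : ℝ) : ℂ))) •
        LinearMap.transvection (innerSL ℂ z : Cn n →ₗ[ℂ] ℂ) v := rfl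
  have hdet : LinearMap.det ((moebiusDeriv z w : Cn n →L[ℂ] Cn n) : Cn n →ₗ[ℂ] Cn n)
      = (-1) ^ n * (((Real.sqrt (1 - ‖z‖ ^ 2) : ℝ) : ℂ) / (1 - inner ℂ z w)) ^ (n + 1) := by
    rw [hlin, LinearMap.det_smul, LinearMap.transvection.det, finrank_euclideanSpace_fin]
    simp only [ContinuousLinearMap.coe_coe, innerSL_apply_apply, hinner]
    rw [neg_pow, pow_succ]
    ring
  have h2 : ((moebiusDeriv z w).restrictScalars ℝ).det = LinearMap.det
      (((moebiusDeriv z w : Cn n →L[ℂ] Cn n) : Cn n →ₗ[ℂ] Cn n).restrictScalars ℝ) := rfl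
  rw [h2, LinearMap.det_restrictScalars, Algebra.norm_complex_apply, hdet, Complex.normSq_eq_norm_sq,
    norm_mul, norm_pow, norm_pow, norm_neg, norm_one, one_pow, one_mul, norm_div, Complex.norm_real,
    Real.norm_eq_abs, abs_of_nonneg (Real.sqrt_nonneg _), ← pow_mul, mul_comm, pow_mul, div_pow,
    Real.sq_sqrt hs.le]

/-- The modulus of the real Jacobian of `moebius z`. -/
def jac {n : ℕ} (z w : Cn n) : ℝ := ((1 - ‖z‖ ^ 2) / ‖(1 - inner ℂ z w : ℂ)‖ ^ 2) ^ (n + 1)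

theorem jac_nonneg {n : ℕ} {z : Cn n} (hz : z ∈ unitBall n) (w : Cn n) : 0 ≤ jac z w :=
  pow_nonneg (div_nonneg (one_sub_norm_sq_pos hz).le (sq_nonneg _)) _

theorem moebius_image {n : ℕ} {z : Cn n} (hz : z ∈ unitBall n) :
    moebius z '' unitBall n = unitBall n := by
  ext w
  constructor
  · rintro ⟨u, hu, rfl⟩
    exact moebius_mem hz hu
  · exact fun hw => ⟨_, moebius_mem hz hw, moebius_moebius hz hw⟩

theorem moebius_injOn {n : ℕ} {z : Cn n} (hz : z ∈ unitBall n) :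
    Set.InjOn (moebius z) (unitBall n) := fun u hu v hv h => by
  rw [← moebius_moebius hz hu, h, moebius_moebius hz hv]

theorem measurableSet_unitBall (n : ℕ) : MeasurableSet (unitBall n) :=
  Metric.isOpen_ball.measurableSet

theorem hasFDerivWithinAt_moebius {n : ℕ} {z : Cn n} (hz : z ∈ unitBall n) :
    ∀ w ∈ unitBall n, HasFDerivWithinAt (moebius z) ((moebiusDeriv z w).restrictScalars ℝ)
      (unitBall n) w :=
  fun _ hw => ((hasFDerivAt_moebius hz hw).restrictScalars ℝ).hasFDerivWithinAt

theorem abs_det_moebiusDeriv {n : ℕ} {z w : Cn n} (hz : z ∈ unitBall n) (hw : w ∈ unitBall n) :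
    |((moebiusDeriv z w).restrictScalars ℝ).det| = jac z w := by
  rw [det_moebiusDeriv hz hw]
  exact abs_of_nonneg (jac_nonneg hz w)

theorem lintegral_comp_moebius {n : ℕ} {z : Cn n} (hz : z ∈ unitBall n) (F : Cn n → ℝ≥0∞) :
    ∫⁻ w, F w ∂(vol n) = ∫⁻ u, ENNReal.ofReal (jac z u) * F (moebius z u) ∂(vol n) := by
  have h := lintegral_image_eq_lintegral_abs_det_fderiv_mul (volume : Measure (Cn n))
    (measurableSet_unitBall n) (hasFDerivWithinAt_moebius hz) (moebius_injOn hz) F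
  rw [moebius_image hz] at h
  rw [vol, lintegral_smul_measure, lintegral_smul_measure, h]
  congr 1
  exact setLIntegral_congr_fun (measurableSet_unitBall n) fun u hu => by
    simp only [abs_det_moebiusDeriv hz hu]

theorem integral_comp_moebius {n : ℕ} {z : Cn n} (hz : z ∈ unitBall n) (F : Cn n → ℂ) :
    ∫ w, F w ∂(vol n) = ∫ u, jac z u • F (moebius z u) ∂(vol n) := by
  have h := integral_image_eq_integral_abs_det_fderiv_smul (volume : Measure (Cn n))
    (measurableSet_unitBall n) (hasFDerivWithinAt_moebius hz) (moebius_injOn hz) F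
  rw [moebius_image hz] at h
  rw [vol, integral_smul_measure, integral_smul_measure, h]
  congr 1
  exact setIntegral_congr_fun (measurableSet_unitBall n) fun u hu => by
    simp only [abs_det_moebiusDeriv hz hu]

theorem integrable_vol_iff {n : ℕ} {F : Cn n → ℂ} :
    Integrable F (vol n) ↔ IntegrableOn F (unitBall n) volume :=
  integrable_smul_measure (ENNReal.inv_ne_zero.2 measure_ball_lt_top.ne)
    (ENNReal.inv_ne_top.2 (volume_unitBall_ne_zero n))

theorem integrable_comp_moebius {n : ℕ} {z : Cn n} (hz : z ∈ unitBall n) {F : Cn n → ℂ}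
    (hF : Integrable F (vol n)) :
    Integrable (fun u => jac z u • F (moebius z u)) (vol n) := by
  have h := integrableOn_image_iff_integrableOn_abs_det_fderiv_smul (volume : Measure (Cn n))
    (measurableSet_unitBall n) (hasFDerivWithinAt_moebius hz) (moebius_injOn hz) F
  rw [moebius_image hz] at h
  rw [integrable_vol_iff] at hF ⊢
  refine (h.1 hF).congr_fun (fun u hu => ?_) (measurableSet_unitBall n)
  simp only [abs_det_moebiusDeriv hz hu]

/-! ### The mean value property at the origin -/

instance instIsProbabilityMeasureVol (n : ℕ) : IsProbabilityMeasure (vol n) := by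
  constructor
  rw [vol, Measure.smul_apply, Measure.restrict_apply_univ, smul_eq_mul]
  exact ENNReal.inv_mul_cancel (volume_unitBall_ne_zero n) measure_ball_lt_top.ne

theorem measurePreserving_smul_vol {n : ℕ} {c : ℂ} (hc : ‖c‖ = 1) :
    MeasurePreserving (fun w : Cn n => c • w) (vol n) (vol n) := by
  have hc0 : c ≠ 0 := by rintro rfl; simp at hc
  let U : Cn n ≃ₗᵢ[ℝ] Cn n :=
    { toLinearEquiv := (LinearEquiv.smulOfNeZero ℂ (Cn n) c hc0).restrictScalars ℝ
      norm_map' := fun w => by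
        change ‖c • w‖ = ‖w‖
        rw [norm_smul, hc, one_mul] }
  have h := (U.measurePreserving).restrict_preimage (measurableSet_unitBall n)
  have hpre : U ⁻¹' unitBall n = unitBall n := by
    ext w
    simp [unitBall]
  rw [hpre] at h
  exact h.smul_measure _

theorem stronglyMeasurable_indicator_unitBall {n : ℕ} {h : Cn n → ℂ}
    (hh : ContinuousOn h (unitBall n)) : StronglyMeasurable ((unitBall n).indicator h) := by
  classical
  refine Measurable.stronglyMeasurable ?_
  have := hh.measurable_piecewise (continuousOn_const (c := (0 : ℂ)) (s := (unitBall n)ᶜ))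
    (measurableSet_unitBall n)
  change Measurable ((unitBall n).piecewise h 0) at this
  rwa [Set.piecewise_eq_indicator] at this

theorem aestronglyMeasurable_vol_of_continuousOn {n : ℕ} {E : Type*} [TopologicalSpace E]
    [TopologicalSpace.PseudoMetrizableSpace E] {h : Cn n → E}
    (hh : ContinuousOn h (unitBall n)) : AEStronglyMeasurable h (vol n) :=
  (hh.aestronglyMeasurable (measurableSet_unitBall n)).smul_measure _

/-- This is the one-variable mean value property on the slice `ζ ↦ h (ζ w)`, which is defined on the
closed unit disc because `|w| < 1`. -/
theorem integral_circleMap_smul {n : ℕ} {h : Cn n → ℂ} (hd : DifferentiableOn ℂ h (unitBall n))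
    {w : Cn n} (hw : w ∈ unitBall n) :
    ∫ θ in (0 : ℝ)..2 * Real.pi, h (circleMap 0 1 θ • w) = 2 * Real.pi * h 0 := by
  have hmaps : Set.MapsTo (fun ζ : ℂ => ζ • w) (Metric.closedBall 0 1) (unitBall n) := by
    intro ζ hζ
    simp only [unitBall, Metric.mem_ball, Metric.mem_closedBall, dist_zero_right] at hw hζ ⊢
    rw [norm_smul]
    nlinarith [norm_nonneg ζ, norm_nonneg w]
  have hf : DifferentiableOn ℂ (fun ζ : ℂ => h (ζ • w)) (Metric.closedBall 0 1) :=
    hd.comp (by fun_prop) hmaps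
  have h1 := DiffContOnCl.circleAverage (f := fun ζ : ℂ => h (ζ • w)) (R := 1) (c := 0) (by
    rw [abs_one]
    refine DifferentiableOn.diffContOnCl ?_
    rwa [closure_ball (0 : ℂ) one_ne_zero])
  rw [Real.circleAverage_def, zero_smul] at h1
  have hpi : (2 * Real.pi : ℂ) ≠ 0 := by
    simp [Real.pi_ne_zero]
  rw [← h1, Complex.real_smul]
  push_cast
  rw [mul_inv_cancel_left₀ hpi]

/-- The mean value property: the integral of a holomorphic function over the ball is its value
at the origin. -/
theorem integral_vol_eq_apply_zero {n : ℕ} {h : Cn n → ℂ} (hd : DifferentiableOn ℂ h (unitBall n))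
    (hi : Integrable h (vol n)) : ∫ w, h w ∂(vol n) = h 0 := by
  -- Extending by zero makes the function measurable everywhere, so that it may be composed with
  -- `(θ, w) ↦ e^{iθ} w` for Fubini. Rotation invariance then replaces the integral over the ball by
  -- its average over circles.
  set h' := (unitBall n).indicator h with hh'
  have hae : h' =ᵐ[vol n] h := by
    filter_upwards [ae_mem_unitBall n] with w hw
    exact Set.indicator_of_mem hw h
  have hi' : Integrable h' (vol n) := hi.congr hae.symm
  have hsm : StronglyMeasurable h' := stronglyMeasurable_indicator_unitBall hd.continuousOn
  have hrot : ∀ θ : ℝ, MeasurePreserving (fun w : Cn n => circleMap 0 1 θ • w) (vol n) (vol n) :=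
    fun θ => measurePreserving_smul_vol (by simp)
  have hint : ∀ θ : ℝ, ∫ w, h' (circleMap 0 1 θ • w) ∂(vol n) = ∫ w, h w ∂(vol n) := fun θ => by
    rw [← integral_congr_ae hae, ← (hrot θ).map_eq, integral_map (hrot θ).aemeasurable
      hsm.aestronglyMeasurable, (hrot θ).map_eq]
  have hprod : Integrable (Function.uncurry fun (θ : ℝ) (w : Cn n) => h' (circleMap 0 1 θ • w))
      ((volume.restrict (Set.uIoc 0 (2 * Real.pi))).prod (vol n)) := by
    have hmeas : StronglyMeasurable
        (Function.uncurry fun (θ : ℝ) (w : Cn n) => h' (circleMap 0 1 θ • w)) := by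
      refine hsm.comp_measurable (g := fun q : ℝ × Cn n => circleMap 0 1 q.1 • q.2) ?_
      exact Continuous.measurable (by fun_prop)
    rw [integrable_prod_iff hmeas.aestronglyMeasurable]
    refine ⟨Eventually.of_forall fun θ => (hrot θ).integrable_comp_of_integrable hi', ?_⟩
    have : ∀ θ : ℝ, ∫ w, ‖h' (circleMap 0 1 θ • w)‖ ∂(vol n) = ∫ w, ‖h' w‖ ∂(vol n) := fun θ => by
      conv_rhs => rw [← (hrot θ).map_eq, integral_map (hrot θ).aemeasurable
        hsm.norm.aestronglyMeasurable]
    simp only [Function.uncurry_apply_pair, this]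
    have : IsFiniteMeasure ((volume : Measure ℝ).restrict (Set.uIoc 0 (2 * Real.pi))) :=
      ⟨by rw [Measure.restrict_apply_univ, Set.uIoc]; exact measure_Ioc_lt_top⟩
    exact integrable_const _
  have hswap := intervalIntegral_integral_swap hprod
  simp only [hint, intervalIntegral.integral_const, sub_zero] at hswap
  have hpi : (2 * Real.pi : ℂ) ≠ 0 := by
    simp [Real.pi_ne_zero]
  have hr : ∫ w, (∫ θ in (0 : ℝ)..2 * Real.pi, h' (circleMap 0 1 θ • w)) ∂(vol n)
      = 2 * Real.pi * h 0 := by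
    have : (fun w => ∫ θ in (0 : ℝ)..2 * Real.pi, h' (circleMap 0 1 θ • w)) =ᵐ[vol n]
        fun _ => 2 * Real.pi * h 0 := by
      filter_upwards [ae_mem_unitBall n] with w hw
      rw [← integral_circleMap_smul hd hw]
      refine intervalIntegral.integral_congr fun θ _ => Set.indicator_of_mem ?_ h
      simpa [unitBall, norm_smul] using hw
    rw [integral_congr_ae this]
    simp
  rw [hr, Complex.real_smul] at hswap
  push_cast at hswap
  exact mul_left_cancel₀ hpi hswap

/-! ### The reproducing property and the norm of the kernel -/

theorem rpow_ofReal_ne_zero {n : ℕ} {z : Cn n} (hz : z ∈ unitBall n) (a : ℝ) :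
    (((1 - ‖z‖ ^ 2) ^ a : ℝ) : ℂ) ≠ 0 := by
  exact_mod_cast (Real.rpow_pos_of_pos (one_sub_norm_sq_pos hz) a).ne'

theorem K_eq_inv_smul_k {n : ℕ} {z : Cn n} (hz : z ∈ unitBall n) :
    K z = ((((1 - ‖z‖ ^ 2) ^ (((n : ℝ) + 1) / 2) : ℝ) : ℂ)⁻¹) • k z := by
  ext w
  rw [Pi.smul_apply, smul_eq_mul, k, inv_mul_cancel_left₀ (rpow_ofReal_ne_zero hz _)]

theorem differentiableOn_K {n : ℕ} {z : Cn n} (hz : z ∈ unitBall n) :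
    DifferentiableOn ℂ (K z) (unitBall n) := by
  rw [K_eq_inv_smul_k hz]
  exact (differentiableOn_k hz).const_smul _

theorem memLp_K {n : ℕ} (p : ℝ≥0∞) {z : Cn n} (hz : z ∈ unitBall n) : MemLp (K z) p (vol n) := by
  rw [K_eq_inv_smul_k hz]
  exact (memLp_k p hz).const_smul _

theorem K_conj {n : ℕ} (z w : Cn n) : (starRingEnd ℂ) (K z w) = K w z := by
  simp [K, inner_conj_symm]

theorem norm_K_comm {n : ℕ} (z w : Cn n) : ‖K z w‖ = ‖K w z‖ := by
  rw [← K_conj, RCLike.norm_conj]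

/-- The integral operator with the Bergman kernel, on functions. -/
def projFun {n : ℕ} (f : Cn n → ℂ) (z : Cn n) : ℂ := ∫ w, K w z * f w ∂(vol n)

/-- Since `1 - ⟨z, φ_z(u)⟩` is `1 - |z|²` over the conjugate of `1 - ⟨u, z⟩`, the Jacobian cancels
the powers of `1 - |z|²` and the conjugate factors. What remains is holomorphic in `u`, so the mean
value property applies after the substitution `w = φ_z(u)`. -/
theorem jac_smul_K_moebius {n : ℕ} {z u : Cn n} (hz : z ∈ unitBall n) (hu : u ∈ unitBall n) :
    ((jac z u : ℝ) : ℂ) * K (moebius z u) z = K z u := by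
  have ha := one_sub_inner_ne_zero hz hu
  have hs : ((1 - ‖z‖ ^ 2 : ℝ) : ℂ) ≠ 0 := by exact_mod_cast (one_sub_norm_sq_pos hz).ne'
  have hac : (starRingEnd ℂ) (1 - inner ℂ z u : ℂ) ≠ 0 := (map_ne_zero _).2 ha
  have h1 : (1 - inner ℂ (moebius z u) z : ℂ)
      = ((1 - ‖z‖ ^ 2 : ℝ) : ℂ) / (starRingEnd ℂ) (1 - inner ℂ z u) := by
    rw [← inner_conj_symm, ← Complex.conj_ofReal, ← map_div₀, ← one_sub_inner_moebius hz hu]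
    simp
  have hn : ((‖(1 - inner ℂ z u : ℂ)‖ ^ 2 : ℝ) : ℂ)
      = (1 - inner ℂ z u) * (starRingEnd ℂ) (1 - inner ℂ z u) := by
    rw [Complex.mul_conj, Complex.normSq_eq_norm_sq]
  rw [K, K, h1, jac, Complex.ofReal_pow, Complex.ofReal_div, hn, ← inv_pow, ← inv_pow, ← mul_pow]
  congr 1
  field_simp

/-- The reproducing property of the Bergman kernel. -/
theorem projFun_eq_of_differentiableOn {n : ℕ} {g : Cn n → ℂ}
    (hd : DifferentiableOn ℂ g (unitBall n)) (hi : Integrable g (vol n)) {z : Cn n}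
    (hz : z ∈ unitBall n) : projFun g z = g z := by
  have hKi : Integrable (fun w => K w z * g w) (vol n) := by
    have h := (memLp_K ⊤ hz).star
    refine (hi.mul_of_top_right h).congr (Eventually.of_forall fun w => ?_)
    simp only [Pi.mul_apply, Pi.star_apply, RCLike.star_def, K_conj]
  have hcongr : (fun u => jac z u • (K (moebius z u) z * g (moebius z u))) =ᵐ[vol n]
      fun u => K z u * g (moebius z u) := by
    filter_upwards [ae_mem_unitBall n] with u hu
    rw [Complex.real_smul, ← mul_assoc, jac_smul_K_moebius hz hu]
  have hi2 := (integrable_comp_moebius hz hKi).congr hcongr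
  have hd2 : DifferentiableOn ℂ (fun u => K z u * g (moebius z u)) (unitBall n) :=
    (differentiableOn_K hz).mul (hd.comp
      (fun u hu => (hasFDerivAt_moebius hz hu).differentiableAt.differentiableWithinAt)
      fun u hu => moebius_mem hz hu)
  -- At `u = 0` the new integrand is `K_z(0) g(φ_z(0)) = g(z)`.
  rw [projFun, integral_comp_moebius hz, integral_congr_ae hcongr,
    integral_vol_eq_apply_zero hd2 hi2, moebius_zero_right]
  simp [K]

theorem integrable_K {n : ℕ} {z : Cn n} (hz : z ∈ unitBall n) : Integrable (K z) (vol n) :=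
  memLp_one_iff_integrable.1 (memLp_K 1 hz)

theorem K_self {n : ℕ} (z : Cn n) : K z z = ((((1 - ‖z‖ ^ 2) ^ (n + 1))⁻¹ : ℝ) : ℂ) := by
  rw [K, inner_self_eq_ofReal]
  push_cast
  rfl

/-- The reproducing property applied to `K_z` at the point `z` gives `‖K_z‖² = K_z(z)`. -/
theorem lintegral_enorm_K_sq {n : ℕ} {z : Cn n} (hz : z ∈ unitBall n) :
    ∫⁻ w, ‖K z w‖ₑ ^ 2 ∂(vol n) = ENNReal.ofReal (((1 - ‖z‖ ^ 2) ^ (n + 1))⁻¹) := by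
  have h := projFun_eq_of_differentiableOn (differentiableOn_K hz) (integrable_K hz) hz
  rw [K_self, projFun] at h
  have h2 : ∀ w, K w z * K z w = ((‖K z w‖ ^ 2 : ℝ) : ℂ) := fun w => by
    rw [← K_conj z w, mul_comm, Complex.mul_conj, Complex.normSq_eq_norm_sq]
  simp only [h2] at h
  rw [integral_complex_ofReal] at h
  have h3 := Complex.ofReal_injective h
  rw [← h3, ofReal_integral_eq_lintegral_ofReal (memLp_K 2 hz).integrable_norm_pow'
    (Eventually.of_forall fun w => by positivity)]
  refine lintegral_congr fun w => ?_
  rw [ENNReal.ofReal_pow (norm_nonneg _), ofReal_norm]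

theorem normK_eq {n : ℕ} {z : Cn n} (hz : z ∈ unitBall n) :
    normK z = (1 - ‖z‖ ^ 2) ^ (-(((n : ℝ) + 1) / 2)) := by
  have hs := one_sub_norm_sq_pos hz
  have h := eLpNorm_eq_lintegral_rpow_enorm_toReal (f := K z) (μ := vol n) (p := 2) (by simp)
    (by simp)
  simp only [ENNReal.toReal_ofNat, ENNReal.rpow_ofNat] at h
  rw [normK, h, lintegral_enorm_K_sq hz, ENNReal.ofReal_rpow_of_pos (by positivity),
    ENNReal.toReal_ofReal (by positivity), Real.rpow_neg hs.le, Real.inv_rpow (by positivity),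
    ← Real.rpow_natCast, ← Real.rpow_mul hs.le]
  push_cast
  ring_nf

/-! ### The Forelli-Rudin estimate -/

/-- In polar coordinates the radial density is at most `(1 - y)^(-t)` on `(0, 1)`, which is
integrable for `t < 1`. -/
theorem lintegral_one_sub_norm_sq_rpow_lt_top {n : ℕ} (hn : 1 ≤ n) {t : ℝ} (ht0 : 0 < t)
    (ht : t < 1) : ∫⁻ w, ENNReal.ofReal ((1 - ‖w‖ ^ 2) ^ (-t)) ∂(vol n) < ⊤ := by
  have : Nonempty (Fin n) := ⟨⟨0, hn⟩⟩
  have : Nontrivial (Cn n) := inferInstance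
  have h1 : IntegrableOn (fun y : ℝ => (1 - y) ^ (-t)) (Set.Ioo 0 1) := by
    have h := intervalIntegral.intervalIntegrable_rpow' (a := 0) (b := 1) (r := -t) (by linarith)
    have h' := (h.comp_sub_left 1).symm
    simp only [sub_zero, sub_self] at h'
    rw [intervalIntegrable_iff_integrableOn_Ioo_of_le zero_le_one] at h'
    exact h'
  have h3 : IntegrableOn (fun y : ℝ => y ^ (Module.finrank ℝ (Cn n) - 1) *
      (1 - y ^ 2) ^ (-t)) (Set.Ioo 0 1) := by
    refine Integrable.mono' h1 (by fun_prop) ?_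
    filter_upwards [ae_restrict_mem measurableSet_Ioo] with y hy
    have hy1 : 0 < 1 - y := sub_pos.2 hy.2
    have hy2 : 1 - y ≤ 1 - y ^ 2 := by nlinarith [hy.1, hy.2]
    rw [Real.norm_of_nonneg (mul_nonneg (pow_nonneg hy.1.le _)
      (Real.rpow_nonneg (hy1.le.trans hy2) _))]
    calc _ ≤ 1 * (1 - y) ^ (-t) :=
          mul_le_mul (pow_le_one₀ hy.1.le hy.2.le)
            (Real.rpow_le_rpow_of_nonpos hy1 hy2 (by linarith))
            (Real.rpow_nonneg (hy1.le.trans hy2) _) zero_le_one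
      _ = _ := one_mul _
  have h6 : IntegrableOn (fun w : Cn n => (1 - ‖w‖ ^ 2) ^ (-t)) (unitBall n) :=
    (integrableOn_fun_norm_addHaar (f := fun y : ℝ => (1 - y ^ 2) ^ (-t)) volume).2 h3
  rw [vol, lintegral_smul_measure]
  refine ENNReal.mul_lt_top (ENNReal.inv_lt_top.2 (volume_unitBall_ne_zero n).bot_lt) ?_
  refine lt_of_le_of_lt (lintegral_mono fun w => ?_) h6.2
  exact Real.ofReal_le_enorm _

/-- The Forelli-Rudin integral `∫ (1 - |w|²)⁻ᵗ |1 - ⟨w, z⟩|⁻ᵅ dv(w)`. -/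
def rudin {n : ℕ} (t : ℝ) (α : ℕ) (z : Cn n) : ℝ≥0∞ :=
  ∫⁻ w, ENNReal.ofReal ((1 - ‖w‖ ^ 2) ^ (-t)) *
    ENNReal.ofReal ((‖(1 - inner ℂ z w : ℂ)‖ ^ α)⁻¹) ∂(vol n)

theorem norm_one_sub_inner_le_two {n : ℕ} {z w : Cn n} (hz : z ∈ unitBall n)
    (hw : w ∈ unitBall n) : ‖(1 - inner ℂ z w : ℂ)‖ ≤ 2 := by
  have h1 := norm_inner_lt_one hz hw
  have h2 := norm_sub_le (1 : ℂ) (inner ℂ z w)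
  rw [norm_one] at h2
  linarith

theorem one_sub_norm_le_one_sub_norm_sq {n : ℕ} {z : Cn n} (hz : z ∈ unitBall n) :
    1 - ‖z‖ ≤ 1 - ‖z‖ ^ 2 := by
  simp only [unitBall, Metric.mem_ball, dist_zero_right] at hz
  nlinarith [norm_nonneg z]

theorem one_sub_norm_pos {n : ℕ} {z : Cn n} (hz : z ∈ unitBall n) : 0 < 1 - ‖z‖ := by
  simpa [unitBall] using hz

theorem jac_mul_weight_moebius_le {n : ℕ} {t : ℝ} (ht0 : 0 < t) (ht : t < 1) {z u : Cn n}
    (hz : z ∈ unitBall n) (hu : u ∈ unitBall n) :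
    jac z u * ((1 - ‖moebius z u‖ ^ 2) ^ (-t) *
        (‖(1 - inner ℂ z (moebius z u) : ℂ)‖ ^ (n + 1 + (n + 1)))⁻¹)
      ≤ 4 * (1 - ‖z‖) ^ (-(((n + 1 : ℕ) : ℝ) + t)) * (1 - ‖u‖ ^ 2) ^ (-t) := by
  have hb := norm_pos_iff.2 (one_sub_inner_ne_zero hz hu)
  have hb2 := norm_one_sub_inner_le_two hz hu
  have hs := one_sub_norm_sq_pos hz
  have hsu := one_sub_norm_sq_pos hu
  have hs1 := one_sub_norm_le_one_sub_norm_sq hz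
  have hs0 := one_sub_norm_pos hz
  rw [one_sub_norm_sq_moebius hz hu, one_sub_inner_moebius hz hu, jac, norm_div, Complex.norm_real,
    Real.norm_eq_abs, abs_of_pos hs]
  generalize ‖(1 - inner ℂ z u : ℂ)‖ = b at *
  generalize 1 - ‖u‖ ^ 2 = v at *
  have h4 : b ^ (2 * t) ≤ 4 := by
    calc b ^ (2 * t) ≤ 2 ^ (2 * t) := Real.rpow_le_rpow hb.le hb2 (by linarith)
      _ ≤ 2 ^ (2 : ℝ) := Real.rpow_le_rpow_of_exponent_le (by norm_num) (by linarith)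
      _ = 4 := by norm_num
  have h5 : (1 - ‖z‖ ^ 2) ^ (-(((n + 1 : ℕ) : ℝ) + t)) ≤ (1 - ‖z‖) ^ (-(((n + 1 : ℕ) : ℝ) + t)) :=
    Real.rpow_le_rpow_of_nonpos hs0 hs1 (by push_cast; linarith [(Nat.cast_nonneg n : (0 : ℝ) ≤ n)])
  generalize 1 - ‖z‖ ^ 2 = s at *
  have h6 : (s * v / b ^ 2) ^ (-t) = s ^ (-t) * v ^ (-t) * b ^ (2 * t) := by
    rw [Real.div_rpow (by positivity) (by positivity), Real.mul_rpow hs.le hsu.le,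
      Real.rpow_neg (sq_nonneg b), ← Real.rpow_natCast, ← Real.rpow_mul hb.le, div_inv_eq_mul]
    norm_num
  have h7 : s ^ (-(((n + 1 : ℕ) : ℝ) + t)) = (s ^ (n + 1))⁻¹ * s ^ (-t) := by
    rw [neg_add, Real.rpow_add hs, Real.rpow_neg hs.le, Real.rpow_natCast]
  have h8 : (s / b ^ 2) ^ (n + 1) * ((s / b) ^ (n + 1 + (n + 1)))⁻¹ = (s ^ (n + 1))⁻¹ := by
    rw [show n + 1 + (n + 1) = 2 * (n + 1) by ring, div_pow s (b ^ 2), div_pow s b, ← pow_mul]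
    field_simp
    ring
  rw [h6]
  calc _ = ((s / b ^ 2) ^ (n + 1) * ((s / b) ^ (n + 1 + (n + 1)))⁻¹) * s ^ (-t) * v ^ (-t)
        * b ^ (2 * t) := by ring
    _ = b ^ (2 * t) * s ^ (-(((n + 1 : ℕ) : ℝ) + t)) * v ^ (-t) := by rw [h8, h7]; ring
    _ ≤ _ := by gcongr

/-- The exponent `2(n + 1)` is the one for which `w = φ_z(u)` removes the denominator: the Jacobian
and the kernel leave only a power of `1 - |z|²`, the weight in `u`, and `|1 - ⟨u, z⟩|^(2t) ≤ 4`. It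
is the start of a descent to the exponent `n + 1`. -/
theorem rudin_top_le {n : ℕ} {t : ℝ} (ht0 : 0 < t) (ht : t < 1) {z : Cn n} (hz : z ∈ unitBall n) :
    rudin t (n + 1 + (n + 1)) z ≤ 4 * rudin t 0 (0 : Cn n) *
      ENNReal.ofReal ((1 - ‖z‖) ^ (-(((n + 1 : ℕ) : ℝ) + t))) := by
  have h0 : rudin t 0 (0 : Cn n) = ∫⁻ w, ENNReal.ofReal ((1 - ‖w‖ ^ 2) ^ (-t)) ∂(vol n) := by
    simp [rudin]
  have hs0 := one_sub_norm_pos hz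
  rw [rudin, lintegral_comp_moebius hz, h0, mul_comm, ← mul_assoc,
    ← lintegral_const_mul _ (by fun_prop)]
  refine lintegral_mono_ae ?_
  filter_upwards [ae_mem_unitBall n] with u hu
  rw [← ENNReal.ofReal_mul (Real.rpow_nonneg (one_sub_norm_sq_pos (moebius_mem hz hu)).le _),
    ← ENNReal.ofReal_mul (jac_nonneg hz u)]
  refine (ENNReal.ofReal_le_ofReal (jac_mul_weight_moebius_le ht0 ht hz hu)).trans (le_of_eq ?_)
  rw [ENNReal.ofReal_mul (by positivity), ENNReal.ofReal_mul (by positivity)]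
  simp [mul_comm]

/-- The fundamental theorem of calculus for `x ↦ (1 - x a)^(-α)` bounds the exponent `α` by an
average of the exponent `α + 1` along the segment from `0` to `a`. -/
theorem inv_norm_one_sub_pow_le {a : ℂ} (ha : ‖a‖ < 1) (α : ℕ) :
    ENNReal.ofReal ((‖1 - a‖ ^ α)⁻¹) ≤ 1 + ∫⁻ x in Set.Ioc (0 : ℝ) 1,
      ENNReal.ofReal (α * ‖a‖ * (‖1 - x * a‖ ^ (α + 1))⁻¹) := by
  have hne : ∀ x ∈ Set.Icc (0 : ℝ) 1, (1 - x * a : ℂ) ≠ 0 := by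
    intro x hx h
    have h1 : ‖(x * a : ℂ)‖ < 1 := by
      rw [norm_mul, Complex.norm_real, Real.norm_of_nonneg hx.1]
      nlinarith [norm_nonneg a, hx.1, hx.2]
    rw [← sub_eq_zero.1 h] at h1
    simp at h1
  have hderiv : ∀ x ∈ Set.uIcc (0 : ℝ) 1,
      HasDerivAt (fun x : ℝ => ((1 - x * a : ℂ) ^ α)⁻¹) (α * a * ((1 - x * a) ^ (α + 1))⁻¹) x := by
    intro x hx
    rw [Set.uIcc_of_le zero_le_one] at hx
    have h0 := hne x hx
    have h1 : HasDerivAt (fun x : ℝ => (1 - x * a : ℂ)) (-(1 * a)) x :=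
      ((Complex.ofRealCLM.hasDerivAt (x := x)).mul_const a).const_sub 1
    have h2 := (h1.pow α).inv (pow_ne_zero _ h0)
    refine h2.congr_deriv ?_
    simp only [Pi.pow_apply]
    rcases α with _ | m
    · simp
    · simp only [Nat.add_sub_cancel]
      field_simp
      ring
  have hcont : ContinuousOn (fun x : ℝ => (α * a * ((1 - x * a) ^ (α + 1))⁻¹ : ℂ))
      (Set.Icc (0 : ℝ) 1) := by
    refine continuousOn_const.mul (ContinuousOn.inv₀ (by fun_prop) fun x hx => ?_)
    exact pow_ne_zero _ (hne x hx)
  have hint : IntervalIntegrable (fun x : ℝ => (α * a * ((1 - x * a) ^ (α + 1))⁻¹ : ℂ))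
      volume 0 1 := by
    refine ContinuousOn.intervalIntegrable ?_
    rwa [Set.uIcc_of_le zero_le_one]
  have hftc := intervalIntegral.integral_eq_sub_of_hasDerivAt hderiv hint
  simp only [Complex.ofReal_one, one_mul, Complex.ofReal_zero, zero_mul, sub_zero, one_pow,
    inv_one] at hftc
  have h1 : ((1 - a) ^ α)⁻¹ = 1 + ∫ x in (0 : ℝ)..1, (α * a * ((1 - x * a) ^ (α + 1))⁻¹ : ℂ) := by
    rw [hftc]; ring
  have h2 : ENNReal.ofReal ((‖1 - a‖ ^ α)⁻¹) = ‖((1 - a) ^ α)⁻¹‖ₑ := by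
    rw [← ofReal_norm, norm_inv, norm_pow]
  rw [h2, h1, intervalIntegral.integral_of_le zero_le_one]
  refine (enorm_add_le _ _).trans (add_le_add (by simp) ?_)
  refine (enorm_integral_le_lintegral_enorm _).trans (le_of_eq (lintegral_congr fun x => ?_))
  rw [← ofReal_norm]
  simp

theorem lintegral_norm_mul_one_sub_rpow_le {r e : ℝ} (hr0 : 0 ≤ r) (hr : r < 1) (he : 1 < e) :
    ∫⁻ x in Set.Ioc (0 : ℝ) 1, ENNReal.ofReal (r * (1 - x * r) ^ (-e))
      ≤ ENNReal.ofReal ((e - 1)⁻¹ * (1 - r) ^ (-(e - 1))) := by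
  have hpos : ∀ x ∈ Set.Icc (0 : ℝ) 1, 0 < 1 - x * r := fun x hx => by nlinarith [hx.1, hx.2]
  have hderiv : ∀ x ∈ Set.uIcc (0 : ℝ) 1,
      HasDerivAt (fun x : ℝ => (e - 1)⁻¹ * (1 - x * r) ^ (-(e - 1))) (r * (1 - x * r) ^ (-e)) x := by
    intro x hx
    rw [Set.uIcc_of_le zero_le_one] at hx
    have h1 : HasDerivAt (fun x : ℝ => 1 - x * r) (-(1 * r)) x :=
      ((hasDerivAt_id x).mul_const r).const_sub 1
    have h2 := (h1.rpow_const (p := -(e - 1)) (Or.inl (hpos x hx).ne')).const_mul (e - 1)⁻¹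
    refine h2.congr_deriv ?_
    rw [show -(e - 1) - 1 = -e by ring]
    have : e - 1 ≠ 0 := by linarith
    field_simp
  have hcont : ContinuousOn (fun x : ℝ => r * (1 - x * r) ^ (-e)) (Set.Icc 0 1) := by
    refine continuousOn_const.mul (ContinuousOn.rpow_const (by fun_prop) fun x hx => ?_)
    exact Or.inl (hpos x hx).ne'
  have hint : IntervalIntegrable (fun x : ℝ => r * (1 - x * r) ^ (-e)) volume 0 1 := by
    refine ContinuousOn.intervalIntegrable ?_
    rwa [Set.uIcc_of_le zero_le_one]
  have hftc := intervalIntegral.integral_eq_sub_of_hasDerivAt hderiv hint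
  rw [intervalIntegral.integral_of_le zero_le_one] at hftc
  rw [intervalIntegrable_iff_integrableOn_Ioc_of_le zero_le_one] at hint
  rw [← ofReal_integral_eq_lintegral_ofReal hint, hftc]
  · refine ENNReal.ofReal_le_ofReal ?_
    have : 0 < (e - 1)⁻¹ := inv_pos.2 (by linarith)
    simp only [one_mul, zero_mul, sub_zero, Real.one_rpow, mul_one]
    linarith
  · filter_upwards [ae_restrict_mem measurableSet_Ioc] with x hx
    exact mul_nonneg hr0 (Real.rpow_nonneg (hpos x (Set.Ioc_subset_Icc_self hx)).le _)

/-- Lowering the exponent of the kernel by one gains one power of `1 - |z|`. The bound for `α + 1`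
is used at the points `x z` and integrated over `0 < x ≤ 1`; the gain requires `e > 1`. -/
theorem rudin_le_of_succ {n : ℕ} {t e : ℝ} {α : ℕ} {C : ℝ≥0∞} (he : 1 < e)
    (hC : ∀ z ∈ unitBall n, rudin t (α + 1) z ≤ C * ENNReal.ofReal ((1 - ‖z‖) ^ (-e)))
    {z : Cn n} (hz : z ∈ unitBall n) :
    rudin t α z ≤ (rudin t 0 (0 : Cn n) + α * C * ENNReal.ofReal (e - 1)⁻¹) *
      ENNReal.ofReal ((1 - ‖z‖) ^ (-(e - 1))) := by
  have hs0 := one_sub_norm_pos hz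
  have hz1 : ‖z‖ < 1 := by linarith
  set W : Cn n → ℝ≥0∞ := fun w => ENNReal.ofReal ((1 - ‖w‖ ^ 2) ^ (-t)) with hW
  have hWm : Measurable W := by rw [hW]; fun_prop
  have h0 : rudin t 0 (0 : Cn n) = ∫⁻ w, W w ∂(vol n) := by
    simp [rudin, hW]
  have hxz : ∀ x ∈ Set.Ioc (0 : ℝ) 1, ((x : ℂ) • z) ∈ unitBall n := fun x hx => by
    simp only [unitBall, Metric.mem_ball, dist_zero_right]
    rw [norm_smul, Complex.norm_real, Real.norm_of_nonneg hx.1.le]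
    nlinarith [norm_nonneg z, hx.1, hx.2]
  calc rudin t α z
      ≤ ∫⁻ w, (W w + ∫⁻ x in Set.Ioc (0 : ℝ) 1, W w * ENNReal.ofReal
          (α * ‖z‖ * (‖(1 - inner ℂ ((x : ℂ) • z) w : ℂ)‖ ^ (α + 1))⁻¹)) ∂(vol n) := by
        refine lintegral_mono_ae ?_
        filter_upwards [ae_mem_unitBall n] with w hw
        rw [lintegral_const_mul _ (by fun_prop)]
        refine (mul_le_mul_right (inv_norm_one_sub_pow_le (norm_inner_lt_one hz hw) α) _).trans ?_
        rw [mul_add, mul_one]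
        refine add_le_add le_rfl (mul_le_mul_right (lintegral_mono fun x =>
          ENNReal.ofReal_le_ofReal ?_) _)
        rw [inner_smul_left, Complex.conj_ofReal]
        refine mul_le_mul_of_nonneg_right (mul_le_mul_of_nonneg_left ?_ (Nat.cast_nonneg _))
          (by positivity)
        calc ‖(inner ℂ z w : ℂ)‖ ≤ ‖z‖ * ‖w‖ := norm_inner_le_norm _ _
          _ ≤ ‖z‖ := mul_le_of_le_one_right (norm_nonneg _) (by linarith [one_sub_norm_pos hw])
    _ = rudin t 0 (0 : Cn n) + ∫⁻ x in Set.Ioc (0 : ℝ) 1,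
          ENNReal.ofReal (α * ‖z‖) * rudin t (α + 1) ((x : ℂ) • z) := by
        rw [lintegral_add_left hWm, ← h0, lintegral_lintegral_swap]
        · congr 1
          refine lintegral_congr fun x => ?_
          rw [rudin, ← lintegral_const_mul _ (by fun_prop)]
          refine lintegral_congr fun w => ?_
          rw [ENNReal.ofReal_mul (by positivity), mul_left_comm]
        · refine Measurable.aemeasurable ?_
          simp only [Function.uncurry_def]
          fun_prop
    _ ≤ rudin t 0 (0 : Cn n) + ∫⁻ x in Set.Ioc (0 : ℝ) 1,
          α * C * ENNReal.ofReal (‖z‖ * (1 - x * ‖z‖) ^ (-e)) := by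
        refine add_le_add le_rfl ?_
        refine setLIntegral_mono' measurableSet_Ioc fun x hx => ?_
        refine (mul_le_mul_right (hC _ (hxz x hx)) _).trans (le_of_eq ?_)
        rw [norm_smul, Complex.norm_real, Real.norm_of_nonneg hx.1.le,
          ENNReal.ofReal_mul (by positivity), ENNReal.ofReal_mul (norm_nonneg z),
          ENNReal.ofReal_natCast]
        ring
    _ ≤ rudin t 0 (0 : Cn n) * ENNReal.ofReal ((1 - ‖z‖) ^ (-(e - 1))) +
          α * C * (ENNReal.ofReal (e - 1)⁻¹ * ENNReal.ofReal ((1 - ‖z‖) ^ (-(e - 1)))) := by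
        rw [lintegral_const_mul _ (by fun_prop)]
        refine add_le_add ?_ ?_
        · refine le_mul_of_one_le_right' (ENNReal.one_le_ofReal.2 ?_)
          exact Real.one_le_rpow_of_pos_of_le_one_of_nonpos hs0 (by linarith [norm_nonneg z])
            (by linarith)
        · rw [← ENNReal.ofReal_mul (by simpa using by linarith)]
          gcongr
          exact lintegral_norm_mul_one_sub_rpow_le (norm_nonneg z) hz1 he
    _ = _ := by ring

theorem exists_rudin_le {n : ℕ} (hn : 1 ≤ n) {t : ℝ} (ht0 : 0 < t) (ht : t < 1) {i : ℕ}
    (hi : i ≤ n + 1) : ∃ C : ℝ≥0∞, C < ⊤ ∧ ∀ z ∈ unitBall n,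
      rudin t (n + 1 + i) z ≤ C * ENNReal.ofReal ((1 - ‖z‖) ^ (-((i : ℝ) + t))) := by
  have h0 : rudin t 0 (0 : Cn n) < ⊤ := by
    simpa [rudin] using lintegral_one_sub_norm_sq_rpow_lt_top hn ht0 ht
  -- The descent runs from `i = n + 1` to `i = 0`. The exponent used is `(i + 1) + t`, which exceeds
  -- `1` even in the last step.
  induction hi using Nat.decreasingInduction with
  | self =>
    exact ⟨_, ENNReal.mul_lt_top (by simp) h0, fun z hz => rudin_top_le ht0 ht hz⟩
  | of_succ i hi ih =>
    obtain ⟨C, hC, h⟩ := ih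
    refine ⟨rudin t 0 (0 : Cn n) + (n + 1 + i : ℕ) * C *
      ENNReal.ofReal (((i + 1 : ℕ) : ℝ) + t - 1)⁻¹, ?_, fun z hz =>
        (rudin_le_of_succ (e := ((i + 1 : ℕ) : ℝ) + t) ?_ h hz).trans_eq ?_⟩
    · exact ENNReal.add_lt_top.2 ⟨h0,
        ENNReal.mul_lt_top (ENNReal.mul_lt_top (ENNReal.natCast_lt_top _) hC) ENNReal.ofReal_lt_top⟩
    · push_cast
      linarith [(Nat.cast_nonneg i : (0 : ℝ) ≤ i)]
    · congr 4
      push_cast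
      ring

/-- The Forelli-Rudin estimate for the Bergman kernel. -/
theorem exists_lintegral_K_le {n : ℕ} (hn : 1 ≤ n) {t : ℝ} (ht0 : 0 < t) (ht : t < 1) :
    ∃ C : ℝ≥0∞, C < ⊤ ∧ ∀ z ∈ unitBall n,
      ∫⁻ w, ‖K w z‖ₑ * ENNReal.ofReal ((1 - ‖w‖ ^ 2) ^ (-t)) ∂(vol n)
        ≤ C * ENNReal.ofReal ((1 - ‖z‖ ^ 2) ^ (-t)) := by
  obtain ⟨C, hC, h⟩ := exists_rudin_le hn ht0 ht (Nat.zero_le (n + 1))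
  refine ⟨C * ENNReal.ofReal (2 ^ t), ENNReal.mul_lt_top hC (by simp), fun z hz => ?_⟩
  have hs := one_sub_norm_sq_pos hz
  calc _ = rudin t (n + 1 + 0) z := by
        refine lintegral_congr fun w => ?_
        rw [mul_comm, ← ofReal_norm, norm_K_comm, K, norm_inv, norm_pow, add_zero]
    _ ≤ _ := h z hz
    _ ≤ _ := by
        rw [mul_assoc, ← ENNReal.ofReal_mul (by positivity)]
        gcongr
        -- Passing from `1 - |z|` to `1 - |z|²` accounts for the factor `2 ^ t`.
        have h1 : (1 - ‖z‖ ^ 2) / 2 ≤ 1 - ‖z‖ := by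
          nlinarith [norm_nonneg z, one_sub_norm_pos hz, sq_nonneg (1 - ‖z‖)]
        calc (1 - ‖z‖) ^ (-(((0 : ℕ) : ℝ) + t)) ≤ ((1 - ‖z‖ ^ 2) / 2) ^ (-t) := by
              simp only [Nat.cast_zero, zero_add]
              exact Real.rpow_le_rpow_of_nonpos (by positivity) h1 (by linarith)
          _ = _ := by
              rw [Real.div_rpow hs.le (by norm_num), Real.rpow_neg (by norm_num : (0 : ℝ) ≤ 2),
                div_inv_eq_mul, mul_comm]

/-! ### The Schur test -/

/-- The Schur test with a single weight. -/
theorem lintegral_rpow_lintegral_mul_le {α : Type*} [MeasurableSpace α] {μ : Measure α} [SFinite μ]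
    {p q : ℝ} (hpq : p.HolderConjugate q) {R : α → α → ℝ≥0∞}
    (hR : Measurable (Function.uncurry R)) {a f : α → ℝ≥0∞} (ha : Measurable a)
    (ha0 : ∀ᵐ x ∂μ, a x ≠ 0 ∧ a x ≠ ⊤) (hf : Measurable f) {C₁ C₂ : ℝ≥0∞}
    (h₁ : ∀ᵐ z ∂μ, ∫⁻ w, R z w * a w ^ q ∂μ ≤ C₁ * a z ^ q)
    (h₂ : ∀ᵐ w ∂μ, ∫⁻ z, R z w * a z ^ p ∂μ ≤ C₂ * a w ^ p) :
    ∫⁻ z, (∫⁻ w, R z w * f w ∂μ) ^ p ∂μ ≤ C₁ ^ (p / q) * C₂ * ∫⁻ w, f w ^ p ∂μ := by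
  have hp := hpq.pos
  have hq := hpq.symm.pos
  have hRz : ∀ z, Measurable (R z) := fun z => hR.comp measurable_prodMk_left
  have hRw : ∀ w, Measurable fun z => R z w := fun w => hR.comp measurable_prodMk_right
  have hsum : p⁻¹ + q⁻¹ = 1 := hpq.inv_add_inv_eq_one
  -- Hölder's inequality for the factorization `R f = (R^(1/p) a⁻¹ f) (R^(1/q) a)`. The first row
  -- condition bounds the `q`-factor, and the power of `a z` it produces is what the second
  -- condition needs after Tonelli.
  have key : ∀ᵐ z ∂μ, (∫⁻ w, R z w * f w ∂μ) ^ p ≤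
      C₁ ^ (p / q) * ∫⁻ w, R z w * a z ^ p * (a w ^ (-p) * f w ^ p) ∂μ := by
    filter_upwards [h₁] with z hz
    have e1 : ∫⁻ w, R z w * f w ∂μ =
        ∫⁻ w, ((fun w => R z w ^ p⁻¹ * ((a w)⁻¹ * f w)) * fun w => R z w ^ q⁻¹ * a w) w ∂μ := by
      refine lintegral_congr_ae ?_
      filter_upwards [ha0] with w hw
      simp only [Pi.mul_apply]
      calc R z w * f w = R z w ^ (p⁻¹ + q⁻¹) * ((a w)⁻¹ * a w) * f w := by
            rw [hsum, ENNReal.rpow_one, ENNReal.inv_mul_cancel hw.1 hw.2, mul_one]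
        _ = _ := by
            rw [ENNReal.rpow_add_of_nonneg _ _ (inv_nonneg.2 hp.le) (inv_nonneg.2 hq.le)]
            ring
    have e2 := ENNReal.lintegral_mul_le_Lp_mul_Lq μ hpq
      (f := fun w => R z w ^ p⁻¹ * ((a w)⁻¹ * f w)) (g := fun w => R z w ^ q⁻¹ * a w)
      (((hRz z).pow_const _).mul (ha.inv.mul hf)).aemeasurable
      (((hRz z).pow_const _).mul ha).aemeasurable
    have e3 : ∀ w, (R z w ^ p⁻¹ * ((a w)⁻¹ * f w)) ^ p = R z w * (a w ^ (-p) * f w ^ p) := fun w => by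
      rw [ENNReal.mul_rpow_of_nonneg _ _ hp.le, ENNReal.mul_rpow_of_nonneg _ _ hp.le,
        ← ENNReal.rpow_mul, inv_mul_cancel₀ hp.ne', ENNReal.rpow_one, ENNReal.inv_rpow,
        ENNReal.rpow_neg]
    have e4 : ∀ w, (R z w ^ q⁻¹ * a w) ^ q = R z w * a w ^ q := fun w => by
      rw [ENNReal.mul_rpow_of_nonneg _ _ hq.le, ← ENNReal.rpow_mul, inv_mul_cancel₀ hq.ne',
        ENNReal.rpow_one]
    simp only [e3, e4] at e2
    rw [e1]
    calc _ ≤ ((∫⁻ w, R z w * (a w ^ (-p) * f w ^ p) ∂μ) ^ (1 / p) *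
          (C₁ * a z ^ q) ^ (1 / q)) ^ p := by
          refine ENNReal.rpow_le_rpow (e2.trans ?_) hp.le
          gcongr
      _ = C₁ ^ (p / q) * (a z ^ p * ∫⁻ w, R z w * (a w ^ (-p) * f w ^ p) ∂μ) := by
          rw [ENNReal.mul_rpow_of_nonneg _ _ hp.le, ← ENNReal.rpow_mul, ← ENNReal.rpow_mul,
            one_div_mul_cancel hp.ne', ENNReal.rpow_one,
            ENNReal.mul_rpow_of_nonneg _ _ (by positivity), ← ENNReal.rpow_mul,
            show q * (1 / q * p) = p by field_simp, show 1 / q * p = p / q by ring]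
          ring
      _ = _ := by
          have hm : Measurable fun w => R z w * (a w ^ (-p) * f w ^ p) :=
            (hRz z).mul ((ha.pow_const _).mul (hf.pow_const _))
          rw [← lintegral_const_mul _ hm]
          congr 1
          refine lintegral_congr fun w => ?_
          ring
  have hm : Measurable (Function.uncurry fun z w => R z w * a z ^ p * (a w ^ (-p) * f w ^ p)) :=
    (hR.mul ((ha.comp measurable_fst).pow_const _)).mul
      (((ha.comp measurable_snd).pow_const _).mul ((hf.comp measurable_snd).pow_const _))
  calc _ ≤ ∫⁻ z, C₁ ^ (p / q) * ∫⁻ w, R z w * a z ^ p * (a w ^ (-p) * f w ^ p) ∂μ ∂μ :=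
        lintegral_mono_ae key
    _ = C₁ ^ (p / q) * ∫⁻ w, (∫⁻ z, R z w * a z ^ p ∂μ) * (a w ^ (-p) * f w ^ p) ∂μ := by
        have hm' : Measurable fun z => ∫⁻ w, R z w * a z ^ p * (a w ^ (-p) * f w ^ p) ∂μ :=
          hm.lintegral_prod_right'
        rw [lintegral_const_mul _ hm', lintegral_lintegral_swap hm.aemeasurable]
        congr 1
        refine lintegral_congr fun w => ?_
        exact lintegral_mul_const _ ((hRw w).mul (ha.pow_const _))
    _ ≤ C₁ ^ (p / q) * ∫⁻ w, C₂ * f w ^ p ∂μ := by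
        refine mul_le_mul_right (lintegral_mono_ae ?_) _
        filter_upwards [h₂, ha0] with w hw hw0
        refine (mul_le_mul_left hw _).trans_eq ?_
        rw [mul_assoc, ← mul_assoc (a w ^ p), ENNReal.rpow_neg, ENNReal.mul_inv_cancel, one_mul]
        · exact (ENNReal.rpow_pos (pos_iff_ne_zero.2 hw0.1) hw0.2).ne'
        · exact ENNReal.rpow_ne_top_of_nonneg hp.le hw0.2
    _ = _ := by rw [lintegral_const_mul _ (hf.pow_const _), mul_assoc]

/-- The Schur test on the ball with a power of `1 - |z|²` as weight. -/
theorem lintegral_rpow_lintegral_mul_le_of_weight {n : ℕ} {p q δ : ℝ} (hpq : p.HolderConjugate q)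
    {R : Cn n → Cn n → ℝ≥0∞} (hR : Measurable (Function.uncurry R)) {f : Cn n → ℝ≥0∞}
    (hf : Measurable f) {C₁ C₂ : ℝ≥0∞}
    (h₁ : ∀ z ∈ unitBall n, ∫⁻ w, R z w * ENNReal.ofReal ((1 - ‖w‖ ^ 2) ^ (-(δ / p))) ∂(vol n)
      ≤ C₁ * ENNReal.ofReal ((1 - ‖z‖ ^ 2) ^ (-(δ / p))))
    (h₂ : ∀ w ∈ unitBall n, ∫⁻ z, R z w * ENNReal.ofReal ((1 - ‖z‖ ^ 2) ^ (-(δ / q))) ∂(vol n)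
      ≤ C₂ * ENNReal.ofReal ((1 - ‖w‖ ^ 2) ^ (-(δ / q)))) :
    ∫⁻ z, (∫⁻ w, R z w * f w ∂(vol n)) ^ p ∂(vol n)
      ≤ C₁ ^ (p / q) * C₂ * ∫⁻ w, f w ^ p ∂(vol n) := by
  have hp := hpq.pos
  have hq := hpq.symm.pos
  -- The exponent `δ / (p q)` makes `a ^ q` and `a ^ p` the weights with exponents `δ / p` and `δ /
  -- q` of the hypotheses.
  set a : Cn n → ℝ≥0∞ := fun w => ENNReal.ofReal ((1 - ‖w‖ ^ 2) ^ (-(δ / (p * q)))) with ha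
  have haq : ∀ w ∈ unitBall n, a w ^ q = ENNReal.ofReal ((1 - ‖w‖ ^ 2) ^ (-(δ / p))) :=
    fun w hw => by
      have hs := one_sub_norm_sq_pos hw
      simp only [ha]
      rw [ENNReal.ofReal_rpow_of_pos (Real.rpow_pos_of_pos hs _), ← Real.rpow_mul hs.le]
      congr 2
      field_simp
  have hap : ∀ w ∈ unitBall n, a w ^ p = ENNReal.ofReal ((1 - ‖w‖ ^ 2) ^ (-(δ / q))) :=
    fun w hw => by
      have hs := one_sub_norm_sq_pos hw
      simp only [ha]
      rw [ENNReal.ofReal_rpow_of_pos (Real.rpow_pos_of_pos hs _), ← Real.rpow_mul hs.le]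
      congr 2
      field_simp
  refine lintegral_rpow_lintegral_mul_le hpq hR (a := a) (by rw [ha]; fun_prop) ?_ hf ?_ ?_
  · filter_upwards [ae_mem_unitBall n] with w hw
    exact ⟨(ENNReal.ofReal_pos.2 (Real.rpow_pos_of_pos (one_sub_norm_sq_pos hw) _)).ne',
      ENNReal.ofReal_ne_top⟩
  · filter_upwards [ae_mem_unitBall n] with z hz
    rw [haq z hz]
    refine le_trans (le_of_eq (lintegral_congr_ae ?_)) (h₁ z hz)
    filter_upwards [ae_mem_unitBall n] with w hw
    rw [haq w hw]
  · filter_upwards [ae_mem_unitBall n] with w hw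
    rw [hap w hw]
    refine le_trans (le_of_eq (lintegral_congr_ae ?_)) (h₂ w hw)
    filter_upwards [ae_mem_unitBall n] with z hz
    rw [hap z hz]

/-! ### The Bergman projection -/

theorem measurable_K (n : ℕ) : Measurable fun q : Cn n × Cn n => K q.1 q.2 := by
  unfold K
  fun_prop

theorem norm_K_le {n : ℕ} {z w : Cn n} {r : ℝ} (hr : r < 1) (hz : ‖z‖ ≤ r) (hw : w ∈ unitBall n) :
    ‖K w z‖ ≤ ((1 - r) ^ (n + 1))⁻¹ := by
  simp only [unitBall, Metric.mem_ball, dist_zero_right] at hw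
  have h1 : 1 - r ≤ ‖(1 - inner ℂ w z : ℂ)‖ := by
    have h2 : ‖(inner ℂ w z : ℂ)‖ ≤ ‖w‖ * ‖z‖ := norm_inner_le_norm w z
    have h3 := norm_sub_norm_le (1 : ℂ) (inner ℂ w z)
    rw [norm_one] at h3
    nlinarith [norm_nonneg z, norm_nonneg w]
  have h4 : 0 < 1 - r := sub_pos.2 hr
  rw [K, norm_inv, norm_pow]
  gcongr

theorem integrable_K_mul {n : ℕ} {f : Cn n → ℂ} (hf : Integrable f (vol n)) {z : Cn n}
    (hz : z ∈ unitBall n) : Integrable (fun w => K w z * f w) (vol n) := by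
  have h := (memLp_K ⊤ hz).star
  refine (hf.mul_of_top_right h).congr (Eventually.of_forall fun w => ?_)
  simp only [Pi.mul_apply, Pi.star_apply, RCLike.star_def, K_conj]

/-- Differentiation under the integral: for `x` within `(1 - |z|)/2` of `z` the denominators `1 -
⟨x, w⟩` are bounded below by `(1 - |z|)/2`, uniformly in `w`. -/
theorem differentiableOn_projFun {n : ℕ} {f : Cn n → ℂ} (hf : Integrable f (vol n)) :
    DifferentiableOn ℂ (projFun f) (unitBall n) := by
  intro z hz
  refine DifferentiableAt.differentiableWithinAt ?_
  have hz0 := one_sub_norm_pos hz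
  set ε : ℝ := (1 - ‖z‖) / 2 with hε
  have hε0 : 0 < ε := by positivity
  have hball : ∀ x ∈ Metric.ball z ε, ‖x‖ ≤ 1 - ε := fun x hx => by
    have h1 := norm_le_norm_add_norm_sub' x z
    rw [Metric.mem_ball, dist_eq_norm] at hx
    linarith
  have hmem : ∀ x ∈ Metric.ball z ε, x ∈ unitBall n := fun x hx => by
    have := hball x hx
    simp only [unitBall, Metric.mem_ball, dist_zero_right]
    linarith
  have hderiv : ∀ᵐ w ∂(vol n), ∀ x ∈ Metric.ball z ε, HasFDerivAt (fun x => K w x * f w)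
      ((f w * ((n + 1) * ((1 - inner ℂ w x) ^ (n + 2))⁻¹)) • innerSL ℂ w) x := by
    filter_upwards [ae_mem_unitBall n] with w hw x hx
    have h0 := one_sub_inner_ne_zero hw (hmem x hx)
    have h1 : HasFDerivAt (fun x : Cn n => (1 - inner ℂ w x : ℂ)) (-innerSL ℂ w) x :=
      (innerSL ℂ w).hasFDerivAt.const_sub 1
    have h2 := ((hasDerivAt_pow (n + 1) (1 - inner ℂ w x : ℂ)).inv
      (pow_ne_zero _ h0)).comp_hasFDerivAt x h1
    refine (h2.mul_const (f w)).congr_fderiv ?_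
    rw [smul_neg, ← neg_smul, smul_smul]
    congr 1
    push_cast
    field_simp
    ring
  refine HasFDerivAt.differentiableAt (hasFDerivAt_integral_of_dominated_of_fderiv_le
    (bound := fun w => ‖f w‖ * ((n + 1) * (ε ^ (n + 2))⁻¹)) (Metric.ball_mem_nhds z hε0) ?_
    (integrable_K_mul hf hz) ?_ ?_ (hf.norm.mul_const _) hderiv)
  · filter_upwards [Metric.ball_mem_nhds z hε0] with x hx
    exact (integrable_K_mul hf (hmem x hx)).aestronglyMeasurable
  · refine AEStronglyMeasurable.smul (hf.aestronglyMeasurable.mul ?_) ?_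
    · exact Measurable.aestronglyMeasurable (by fun_prop)
    · exact (innerSL ℂ : Cn n →L⋆[ℂ] Cn n →L[ℂ] ℂ).continuous.aestronglyMeasurable
  · filter_upwards [ae_mem_unitBall n] with w hw x hx
    have hw1 : ‖w‖ < 1 := by linarith [one_sub_norm_pos hw]
    have h1 : ε ≤ ‖(1 - inner ℂ w x : ℂ)‖ := by
      have h2 : ‖(inner ℂ w x : ℂ)‖ ≤ ‖w‖ * ‖x‖ := norm_inner_le_norm w x
      have h3 := norm_sub_norm_le (1 : ℂ) (inner ℂ w x)
      rw [norm_one] at h3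
      nlinarith [norm_nonneg x, norm_nonneg w, hball x hx]
    have h5 : ‖((n : ℂ) + 1)‖ = n + 1 := by
      have := Complex.norm_natCast (n + 1)
      push_cast at this
      exact this
    rw [norm_smul, innerSL_apply_norm, norm_mul, norm_mul, norm_inv, norm_pow, h5]
    refine (mul_le_of_le_one_right (by positivity) hw1.le).trans ?_
    gcongr

theorem aestronglyMeasurable_projFun {n : ℕ} {f : Cn n → ℂ} (hf : Integrable f (vol n)) :
    AEStronglyMeasurable (projFun f) (vol n) :=
  aestronglyMeasurable_vol_of_continuousOn (differentiableOn_projFun hf).continuousOn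

theorem holderConjugate_toReal {p : ℝ≥0∞} (hp : 1 < p) (hp' : p ≠ ⊤) :
    p.toReal.HolderConjugate p.toReal.conjExponent :=
  Real.HolderConjugate.conjExponent ((ENNReal.toReal_lt_toReal ENNReal.one_ne_top hp').2 hp)

/-- An estimate of integrals of `p`-th powers as an estimate of `Lᵖ` norms. -/
theorem eLpNorm_le_of_lintegral_rpow_le {n : ℕ} {p : ℝ≥0∞} (hp : 1 < p) (hp' : p ≠ ⊤) {f g : Cn n → ℂ} {C : ℝ≥0∞}
    (h : ∫⁻ z, ‖g z‖ₑ ^ p.toReal ∂(vol n) ≤ C * ∫⁻ z, ‖f z‖ₑ ^ p.toReal ∂(vol n)) :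
    eLpNorm g p (vol n) ≤ C ^ (1 / p.toReal) * eLpNorm f p (vol n) := by
  have hp0 : p ≠ 0 := (zero_lt_one.trans hp).ne'
  rw [eLpNorm_eq_lintegral_rpow_enorm_toReal hp0 hp', eLpNorm_eq_lintegral_rpow_enorm_toReal hp0 hp',
    ← ENNReal.mul_rpow_of_nonneg _ _ (by positivity)]
  exact ENNReal.rpow_le_rpow h (by positivity)

theorem exists_eLpNorm_projFun_le {n : ℕ} {p : ℝ≥0∞} (hn : 1 ≤ n) (hp : 1 < p) (hp' : p ≠ ⊤) :
    ∃ C : ℝ≥0∞, C < ⊤ ∧ ∀ f : LpBall n p,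
      eLpNorm (projFun f) p (vol n) ≤ C * eLpNorm f p (vol n) := by
  have hpq := holderConjugate_toReal hp hp'
  set q := p.toReal.conjExponent
  obtain ⟨C₁, hC₁, h₁⟩ := exists_lintegral_K_le hn (inv_pos.2 hpq.pos) (inv_lt_one_of_one_lt₀ hpq.lt)
  obtain ⟨C₂, hC₂, h₂⟩ := exists_lintegral_K_le hn (inv_pos.2 hpq.symm.pos)
    (inv_lt_one_of_one_lt₀ hpq.symm.lt)
  refine ⟨(C₁ ^ (p.toReal / q) * C₂) ^ (1 / p.toReal), ?_, fun f => ?_⟩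
  · have := hpq.pos
    have := hpq.symm.pos
    exact ENNReal.rpow_lt_top_of_nonneg (by positivity) (ENNReal.mul_ne_top
      (ENNReal.rpow_ne_top_of_nonneg (by positivity) hC₁.ne) hC₂.ne)
  · refine eLpNorm_le_of_lintegral_rpow_le hp hp' ?_
    refine le_trans (lintegral_mono fun z => ENNReal.rpow_le_rpow
      (enorm_integral_le_lintegral_enorm _) hpq.nonneg) ?_
    simp only [enorm_mul]
    -- With `δ = 1` the weight exponents are `1/p` and `1/q`, both inside the range `(0, 1)` of the
    -- Forelli-Rudin estimate.
    refine lintegral_rpow_lintegral_mul_le_of_weight (δ := 1) (R := fun z w => ‖K w z‖ₑ) hpq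
      ?_ (Lp.stronglyMeasurable f).enorm ?_ ?_
    · exact ((measurable_K n).comp measurable_swap).enorm
    · simpa only [one_div] using h₁
    · intro w hw
      simp only [one_div, ← ofReal_norm, norm_K_comm w]
      simpa only [← ofReal_norm] using h₂ w hw

section Projection

variable {n : ℕ} {p : ℝ≥0∞} [Fact (1 ≤ p)]

theorem integrable_coeFn (f : LpBall n p) : Integrable f (vol n) :=
  memLp_one_iff_integrable.1 ((Lp.memLp f).mono_exponent Fact.out)

theorem projFun_add {f g : Cn n → ℂ} (hf : Integrable f (vol n)) (hg : Integrable g (vol n))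
    {z : Cn n} (hz : z ∈ unitBall n) : projFun (f + g) z = projFun f z + projFun g z := by
  simp only [projFun, Pi.add_apply, mul_add]
  exact integral_add (integrable_K_mul hf hz) (integrable_K_mul hg hz)

theorem projFun_smul (c : ℂ) (f : Cn n → ℂ) (z : Cn n) : projFun (c • f) z = c * projFun f z := by
  simp only [projFun, Pi.smul_apply, smul_eq_mul, mul_left_comm _ c]
  exact integral_const_mul _ _

theorem projFun_congr_ae {f g : Cn n → ℂ} (h : f =ᵐ[vol n] g) : projFun f = projFun g := by
  ext z
  refine integral_congr_ae ?_
  filter_upwards [h] with w hw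
  rw [hw]

theorem exists_isBergmanProjection (hn : 1 ≤ n) (hp : 1 < p) (hp' : p ≠ ⊤) :
    ∃ P : LpBall n p →L[ℂ] bergmanSpace n p, IsBergmanProjection P := by
  obtain ⟨C, hC, h⟩ := exists_eLpNorm_projFun_le hn hp hp'
  have hmem : ∀ f : LpBall n p, MemLp (projFun f) p (vol n) := fun f =>
    ⟨aestronglyMeasurable_projFun (integrable_coeFn f),
      (h f).trans_lt (ENNReal.mul_lt_top hC (Lp.eLpNorm_lt_top f))⟩
  refine ⟨LinearMap.mkContinuous
    { toFun := fun f => ⟨(hmem f).toLp _, projFun f, differentiableOn_projFun (integrable_coeFn f),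
        (hmem f).coeFn_toLp⟩
      map_add' := fun f g => ?_
      map_smul' := fun c f => ?_ } C.toReal fun f => ?_, fun f => ?_⟩
  · refine Subtype.ext ?_
    change (hmem (f + g)).toLp _ = (hmem f).toLp _ + (hmem g).toLp _
    rw [← MemLp.toLp_add]
    refine MemLp.toLp_congr _ _ ?_
    filter_upwards [ae_mem_unitBall n] with z hz
    rw [projFun_congr_ae (Lp.coeFn_add f g), projFun_add (integrable_coeFn f) (integrable_coeFn g) hz,
      Pi.add_apply]
  · refine Subtype.ext ?_
    change (hmem (c • f)).toLp _ = c • (hmem f).toLp _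
    rw [← MemLp.toLp_const_smul]
    refine MemLp.toLp_congr _ _ (Eventually.of_forall fun z => ?_)
    simp only [projFun_congr_ae (Lp.coeFn_smul c f), projFun_smul, Pi.smul_apply, smul_eq_mul]
  · change ‖(hmem f).toLp _‖ ≤ _
    rw [Lp.norm_toLp, Lp.norm_def, ← ENNReal.toReal_mul]
    exact ENNReal.toReal_mono (ENNReal.mul_lt_top hC (Lp.eLpNorm_lt_top f)).ne (h f)
  · exact (hmem f).coeFn_toLp

end Projection

/-! ### Block sums over sets of bounded overlap -/

section MulInd

variable {n : ℕ} {p : ℝ≥0∞} [Fact (1 ≤ p)]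

theorem coeFn_mulInd {E : Set (Cn n)} (hE : MeasurableSet E) (f : LpBall n p) :
    (mulInd E hE f : LpBall n p) =ᵐ[vol n] E.indicator f := by
  have h : mulInd E hE f = ((Lp.memLp f).indicator hE).toLp (E.indicator f) := rfl
  rw [h]
  exact MemLp.coeFn_toLp _

theorem enorm_rpow_eq_lintegral (hp' : p ≠ ⊤) (f : LpBall n p) :
    ‖f‖ₑ ^ p.toReal = ∫⁻ z, ‖f z‖ₑ ^ p.toReal ∂(vol n) := by
  have hp0 : p ≠ 0 := (zero_lt_one.trans_le (Fact.out : 1 ≤ p)).ne'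
  rw [Lp.enorm_def, eLpNorm_eq_lintegral_rpow_enorm_toReal hp0 hp', ← ENNReal.rpow_mul,
    one_div_mul_cancel (ENNReal.toReal_pos hp0 hp').ne', ENNReal.rpow_one]

theorem toReal_pos_of_fact (hp' : p ≠ ⊤) : 0 < p.toReal :=
  ENNReal.toReal_pos (zero_lt_one.trans_le (Fact.out : 1 ≤ p)).ne' hp'

theorem enorm_mulInd_rpow (hp' : p ≠ ⊤) {E : Set (Cn n)} (hE : MeasurableSet E) (f : LpBall n p) :
    ‖mulInd E hE f‖ₑ ^ p.toReal = ∫⁻ z, E.indicator (fun z => ‖f z‖ₑ ^ p.toReal) z ∂(vol n) := by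
  rw [enorm_rpow_eq_lintegral hp']
  refine lintegral_congr_ae ?_
  filter_upwards [coeFn_mulInd hE f] with z hz
  rw [hz]
  by_cases h : z ∈ E
  · simp [h]
  · simp [h, toReal_pos_of_fact hp']

theorem enorm_mulInd_le {E : Set (Cn n)} (hE : MeasurableSet E) (f : LpBall n p) :
    ‖mulInd E hE f‖ₑ ≤ ‖f‖ₑ := by
  rw [Lp.enorm_def, Lp.enorm_def, eLpNorm_congr_ae (coeFn_mulInd hE f)]
  exact eLpNorm_indicator_le _

theorem mulInd_mulInd_self {E : Set (Cn n)} (hE : MeasurableSet E) (f : LpBall n p) :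
    mulInd E hE (mulInd E hE f) = mulInd E hE f := by
  refine Lp.ext ?_
  filter_upwards [coeFn_mulInd hE f, coeFn_mulInd hE (mulInd E hE f)] with z h1 h2
  rw [h2, h1]
  by_cases h : z ∈ E <;> simp [h, h1]

theorem mulInd_mulInd_of_disjoint {E E' : Set (Cn n)} (hE : MeasurableSet E)
    (hE' : MeasurableSet E') (hd : Disjoint E E') (f : LpBall n p) :
    mulInd E hE (mulInd E' hE' f) = 0 := by
  refine Lp.ext ?_
  filter_upwards [coeFn_mulInd hE' f, coeFn_mulInd hE (mulInd E' hE' f),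
    Lp.coeFn_zero ℂ p (vol n)] with z h1 h2 h3
  rw [h2, h3]
  by_cases h : z ∈ E
  · simp [h, h1, Set.disjoint_left.1 hd h]
  · simp [h]

/-- Pointwise, `|f(z)|^p` is counted once for each `G j` containing `z`, hence at most `N` times. -/
theorem sum_enorm_mulInd_rpow_le (hp' : p ≠ ⊤) {N : ℕ} {G : ℕ → Set (Cn n)}
    (hG : ∀ j, MeasurableSet (G j)) (hN : ∀ z ∈ unitBall n, {j | z ∈ G j}.encard ≤ N)
    (f : LpBall n p) (s : Finset ℕ) :
    ∑ j ∈ s, ‖mulInd (G j) (hG j) f‖ₑ ^ p.toReal ≤ N * ‖f‖ₑ ^ p.toReal := by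
  classical
  have hm : Measurable fun z => ‖f z‖ₑ ^ p.toReal := (Lp.stronglyMeasurable f).enorm.pow_const _
  simp only [enorm_mulInd_rpow hp']
  rw [← lintegral_finsetSum _ fun j _ => hm.indicator (hG j), enorm_rpow_eq_lintegral hp',
    ← lintegral_const_mul _ hm]
  refine lintegral_mono_ae ?_
  filter_upwards [ae_mem_unitBall n] with z hz
  simp only [Set.indicator_apply]
  rw [← Finset.sum_filter, Finset.sum_const, nsmul_eq_mul]
  refine mul_le_mul_left ?_ _
  have h1 : ((s.filter fun j => z ∈ G j : Finset ℕ) : Set ℕ) ⊆ {j | z ∈ G j} := fun j hj => by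
    simpa using (Finset.mem_filter.1 hj).2
  have h2 := (Set.encard_le_encard h1).trans (hN z hz)
  rw [Set.encard_coe_eq_coe_finsetCard] at h2
  exact_mod_cast h2

/-- At each point at most one summand is nonzero, so `p`-th powers of norms add. -/
theorem enorm_sum_mulInd_rpow (hp' : p ≠ ⊤) {F : ℕ → Set (Cn n)} (hF : ∀ j, MeasurableSet (F j))
    (hd : Pairwise fun i j => Disjoint (F i) (F j)) (u : ℕ → LpBall n p) (s : Finset ℕ) :
    ‖∑ j ∈ s, mulInd (F j) (hF j) (u j)‖ₑ ^ p.toReal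
      = ∑ j ∈ s, ‖mulInd (F j) (hF j) (u j)‖ₑ ^ p.toReal := by
  classical
  have hp0 := toReal_pos_of_fact hp'
  simp only [enorm_mulInd_rpow hp']
  rw [enorm_rpow_eq_lintegral hp', ← lintegral_finsetSum _ fun j _ =>
    ((Lp.stronglyMeasurable (u j)).enorm.pow_const _).indicator (hF j)]
  refine lintegral_congr_ae ?_
  have h1 : ∀ᵐ z ∂(vol n), ∀ j, (mulInd (F j) (hF j) (u j) : LpBall n p) z
      = (F j).indicator (u j) z := ae_all_iff.2 fun j => coeFn_mulInd (hF j) (u j)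
  filter_upwards [h1, Lp.coeFn_fun_finsetSum s fun j => mulInd (F j) (hF j) (u j)] with z hz hz2
  rw [hz2]
  simp only [hz]
  by_cases h : ∃ i ∈ s, z ∈ F i
  · obtain ⟨i, hi, hzi⟩ := h
    have hne : ∀ j, j ≠ i → z ∉ F j := fun j hj hzj => Set.disjoint_left.1 (hd hj) hzj hzi
    rw [Finset.sum_eq_single_of_mem i hi fun j _ hj => Set.indicator_of_notMem (hne j hj) _,
      Finset.sum_eq_single_of_mem i hi fun j _ hj => Set.indicator_of_notMem (hne j hj) _]
    simp [hzi]
  · push Not at h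
    rw [Finset.sum_eq_zero fun j hj => Set.indicator_of_notMem (h j hj) _,
      Finset.sum_eq_zero fun j hj => Set.indicator_of_notMem (h j hj) _]
    simp [hp0]

theorem sum_enorm_mulInd_comp_rpow_le (hp' : p ≠ ⊤) {N : ℕ} {F G : ℕ → Set (Cn n)}
    (hF : ∀ j, MeasurableSet (F j)) (hG : ∀ j, MeasurableSet (G j))
    (hN : ∀ z ∈ unitBall n, {j | z ∈ G j}.encard ≤ N)
    (A : LpBall n p →L[ℂ] LpBall n p) (f : LpBall n p) (s : Finset ℕ) :
    ∑ j ∈ s, ‖mulInd (F j) (hF j) (A (mulInd (G j) (hG j) f))‖ₑ ^ p.toReal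
      ≤ ‖A‖ₑ ^ p.toReal * (N * ‖f‖ₑ ^ p.toReal) := by
  have hp0 := toReal_pos_of_fact hp'
  calc _ ≤ ∑ j ∈ s, ‖A‖ₑ ^ p.toReal * ‖mulInd (G j) (hG j) f‖ₑ ^ p.toReal := by
        refine Finset.sum_le_sum fun j _ => ?_
        rw [← ENNReal.mul_rpow_of_nonneg _ _ hp0.le]
        exact ENNReal.rpow_le_rpow ((enorm_mulInd_le _ _).trans (A.le_opENorm _)) hp0.le
    _ ≤ _ := by
        rw [← Finset.mul_sum]
        exact mul_le_mul_right (sum_enorm_mulInd_rpow_le hp' hG hN f s) _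

theorem norm_sum_mulInd_comp_le (hp' : p ≠ ⊤) {N : ℕ} {F G : ℕ → Set (Cn n)}
    (hF : ∀ j, MeasurableSet (F j)) (hd : Pairwise fun i j => Disjoint (F i) (F j))
    (hG : ∀ j, MeasurableSet (G j)) (hN : ∀ z ∈ unitBall n, {j | z ∈ G j}.encard ≤ N)
    (A : LpBall n p →L[ℂ] LpBall n p) (f : LpBall n p) (s : Finset ℕ) :
    ‖∑ j ∈ s, mulInd (F j) (hF j) (A (mulInd (G j) (hG j) f))‖
      ≤ (N : ℝ) ^ (1 / p.toReal) * ‖A‖ * ‖f‖ := by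
  have hp0 := toReal_pos_of_fact hp'
  have h := (enorm_sum_mulInd_rpow hp' hF hd (fun j => A (mulInd (G j) (hG j) f)) s).trans_le
    (sum_enorm_mulInd_comp_rpow_le hp' hF hG hN A f s)
  have h2 := ENNReal.toReal_mono (by finiteness) h
  simp only [ENNReal.toReal_mul, ← ENNReal.toReal_rpow, toReal_enorm, ENNReal.toReal_natCast] at h2
  rw [← Real.rpow_le_rpow_iff (norm_nonneg _) (by positivity) hp0, Real.mul_rpow (by positivity)
    (norm_nonneg _), Real.mul_rpow (by positivity) (norm_nonneg _), ← Real.rpow_mul (by positivity),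
    one_div_mul_cancel hp0.ne', Real.rpow_one]
  linarith

/-- The `p`-th power of the norm of any finite partial sum is the partial sum of a real series with
bounded partial sums. The Cauchy criterion passes from that series to the vectors; absolute
convergence is not claimed. -/
theorem summable_mulInd_comp (hp' : p ≠ ⊤) {N : ℕ} {F G : ℕ → Set (Cn n)}
    (hF : ∀ j, MeasurableSet (F j)) (hd : Pairwise fun i j => Disjoint (F i) (F j))
    (hG : ∀ j, MeasurableSet (G j)) (hN : ∀ z ∈ unitBall n, {j | z ∈ G j}.encard ≤ N)
    (A : LpBall n p →L[ℂ] LpBall n p) (f : LpBall n p) :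
    Summable fun j => mulInd (F j) (hF j) (A (mulInd (G j) (hG j) f)) := by
  have hp0 := toReal_pos_of_fact hp'
  have hreal : ∀ s : Finset ℕ, ‖∑ j ∈ s, mulInd (F j) (hF j) (A (mulInd (G j) (hG j) f))‖ ^ p.toReal
      = ∑ j ∈ s, ‖mulInd (F j) (hF j) (A (mulInd (G j) (hG j) f))‖ ^ p.toReal := fun s => by
    have h := congrArg ENNReal.toReal
      (enorm_sum_mulInd_rpow hp' hF hd (fun j => A (mulInd (G j) (hG j) f)) s)
    rw [ENNReal.toReal_sum fun j _ => by finiteness] at h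
    simpa only [← ENNReal.toReal_rpow, toReal_enorm] using h
  have hsum : Summable fun j => ‖mulInd (F j) (hF j) (A (mulInd (G j) (hG j) f))‖ ^ p.toReal := by
    refine summable_of_sum_le (fun j => by positivity) (c := ((N : ℝ) ^ (1 / p.toReal) * ‖A‖ * ‖f‖)
      ^ p.toReal) fun s => ?_
    rw [← hreal]
    exact Real.rpow_le_rpow (norm_nonneg _) (norm_sum_mulInd_comp_le hp' hF hd hG hN A f s) hp0.le
  rw [summable_iff_vanishing_norm] at hsum ⊢
  intro ε hε
  obtain ⟨s, hs⟩ := hsum (ε ^ p.toReal) (Real.rpow_pos_of_pos hε _)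
  refine ⟨s, fun t ht => ?_⟩
  have h := hs t ht
  rw [← hreal, Real.norm_of_nonneg (by positivity)] at h
  exact (Real.rpow_lt_rpow_iff (norm_nonneg _) hε.le hp0).1 h

/-- The operator `∑ⱼ M_{1_{Fⱼ}} A M_{1_{Gⱼ}}` for disjoint `Fⱼ` and `Gⱼ` of finite multiplicity. -/
theorem exists_hasSum_mulInd_comp (hp' : p ≠ ⊤) {N : ℕ} {F G : ℕ → Set (Cn n)}
    (hF : ∀ j, MeasurableSet (F j)) (hd : Pairwise fun i j => Disjoint (F i) (F j))
    (hG : ∀ j, MeasurableSet (G j)) (hN : ∀ z ∈ unitBall n, {j | z ∈ G j}.encard ≤ N)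
    (A : LpBall n p →L[ℂ] LpBall n p) :
    ∃ S : LpBall n p →L[ℂ] LpBall n p,
      (∀ f, HasSum (fun j => mulInd (F j) (hF j) (A (mulInd (G j) (hG j) f))) (S f)) ∧
      ‖S‖ ≤ (N : ℝ) ^ (1 / p.toReal) * ‖A‖ := by
  have hs := fun f => (summable_mulInd_comp hp' hF hd hG hN A f).hasSum
  have hbound : ∀ f, ‖∑' j, mulInd (F j) (hF j) (A (mulInd (G j) (hG j) f))‖
      ≤ (N : ℝ) ^ (1 / p.toReal) * ‖A‖ * ‖f‖ := fun f =>
    le_of_tendsto (hs f).norm (Eventually.of_forall fun s =>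
      norm_sum_mulInd_comp_le hp' hF hd hG hN A f s)
  refine ⟨LinearMap.mkContinuous
    { toFun := fun f => ∑' j, mulInd (F j) (hF j) (A (mulInd (G j) (hG j) f))
      map_add' := fun f g => ?_
      map_smul' := fun c f => ?_ } _ hbound, hs, LinearMap.mkContinuous_norm_le _ (by positivity) _⟩
  · have h := (hs f).add (hs g)
    simp only [← map_add] at h
    exact h.tsum_eq
  · have h := (hs f).const_smul c
    simp only [← map_smul] at h
    exact h.tsum_eq

end MulInd

/-! ### The integral representation of `TP` -/

section Representation

variable {n : ℕ} {p : ℝ≥0∞}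

/-- The reproducing kernel `K_z` as an element of `Aᵖ`, for `z` in the ball. -/
def kernelLp (n : ℕ) (p : ℝ≥0∞) (z : Cn n) : bergmanSpace n p :=
  open Classical in
  if hz : z ∈ unitBall n then
    ⟨(memLp_K p hz).toLp (K z), K z, differentiableOn_K hz, (memLp_K p hz).coeFn_toLp⟩
  else 0

theorem coe_kernelLp {z : Cn n} (hz : z ∈ unitBall n) :
    (kernelLp n p z : LpBall n p) = (memLp_K p hz).toLp (K z) := by
  rw [kernelLp, dif_pos hz]

theorem kernel_eq_smul_kernelLp {z : Cn n} (hz : z ∈ unitBall n) :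
    kernel n p z = (((1 - ‖z‖ ^ 2) ^ (((n : ℝ) + 1) / 2) : ℝ) : ℂ) • kernelLp n p z := by
  refine Subtype.ext ?_
  rw [Submodule.coe_smul, coe_kernelLp hz, kernel, dif_pos hz, ← MemLp.toLp_const_smul]
  rfl

theorem norm_le_of_ae_norm_le (f : LpBall n p) {C : ℝ} (hC : 0 ≤ C)
    (h : ∀ᵐ x ∂(vol n), ‖f x‖ ≤ C) : ‖f‖ ≤ C := by
  simpa [measureUnivNNReal] using Lp.norm_le_of_ae_bound hC h

theorem projFun_kernelLp {z w : Cn n} (hz : z ∈ unitBall n) (hw : w ∈ unitBall n) :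
    projFun (kernelLp n p w : LpBall n p) z = K w z := by
  rw [coe_kernelLp hw, projFun_congr_ae (memLp_K p hw).coeFn_toLp,
    projFun_eq_of_differentiableOn (differentiableOn_K hw) (integrable_K hw) hz]

theorem norm_kernelLp_le {z : Cn n} {r : ℝ} (hr : r < 1) (hz : ‖z‖ ≤ r) :
    ‖(kernelLp n p z : LpBall n p)‖ ≤ ((1 - r) ^ (n + 1))⁻¹ := by
  have hr0 : 0 < 1 - r := sub_pos.2 hr
  have hzB : z ∈ unitBall n := by simpa [unitBall] using hz.trans_lt hr
  refine norm_le_of_ae_norm_le _ (by positivity) ?_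
  rw [coe_kernelLp hzB]
  filter_upwards [(memLp_K p hzB).coeFn_toLp, ae_mem_unitBall n] with w h1 h2
  rw [h1, norm_K_comm]
  exact norm_K_le hr hz h2

variable [Fact (1 ≤ p)]

/-- The kernel is jointly continuous on the open ball times the compact closed ball, so `K_w → K_z`
uniformly. Since `vol n` has mass one, uniform closeness bounds the `Lᵖ` distance. -/
theorem continuousOn_kernelLp : ContinuousOn (kernelLp n p) (unitBall n) := by
  intro z hz
  have hc : ContinuousOn (Function.uncurry (K : Cn n → Cn n → ℂ))
      (unitBall n ×ˢ Metric.closedBall 0 1) := by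
    unfold K
    refine ContinuousOn.inv₀ (by fun_prop) fun x hx => pow_ne_zero _ fun h => ?_
    have h1 : ‖x.1‖ < 1 := by simpa [unitBall] using hx.1
    have h2 : ‖x.2‖ ≤ 1 := by simpa using hx.2
    have h3 : ‖(inner ℂ x.1 x.2 : ℂ)‖ ≤ ‖x.1‖ * ‖x.2‖ := norm_inner_le_norm _ _
    rw [← sub_eq_zero.1 h, norm_one] at h3
    nlinarith [norm_nonneg x.1, norm_nonneg x.2]
  rw [ContinuousWithinAt, Metric.tendsto_nhds]
  intro ε hε
  obtain ⟨v, hv, h⟩ := (isCompact_closedBall (0 : Cn n) 1).mem_uniformity_of_prod hc hz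
    (Metric.dist_mem_uniformity (half_pos hε))
  filter_upwards [hv, self_mem_nhdsWithin] with w hw hwB
  rw [dist_eq_norm, ← Submodule.norm_coe, Submodule.coe_sub, coe_kernelLp hz, coe_kernelLp hwB]
  refine (norm_le_of_ae_norm_le _ (half_pos hε).le ?_).trans_lt (half_lt_self hε)
  filter_upwards [Lp.coeFn_sub ((memLp_K p hwB).toLp (K w)) ((memLp_K p hz).toLp (K z)),
    (memLp_K p hz).coeFn_toLp, (memLp_K p hwB).coeFn_toLp, ae_mem_unitBall n] with x h1 h2 h3 h4
  rw [h1, Pi.sub_apply, h2, h3, ← dist_eq_norm]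
  exact (h w hw x (Metric.ball_subset_closedBall h4)).le

theorem integral_norm_le_norm (f : LpBall n p) : ∫ w, ‖f w‖ ∂(vol n) ≤ ‖f‖ := by
  have h := eLpNorm_le_eLpNorm_of_exponent_le (Fact.out : 1 ≤ p) (Lp.aestronglyMeasurable f)
  rw [Lp.norm_def, integral_norm_eq_lintegral_enorm (Lp.aestronglyMeasurable f),
    ← eLpNorm_one_eq_lintegral_enorm]
  exact ENNReal.toReal_mono (Lp.eLpNorm_ne_top f) h

theorem norm_projFun_le (f : LpBall n p) {z : Cn n} {r : ℝ} (hr : r < 1) (hz : ‖z‖ ≤ r) :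
    ‖projFun f z‖ ≤ ((1 - r) ^ (n + 1))⁻¹ * ‖f‖ := by
  have hr0 : 0 < 1 - r := sub_pos.2 hr
  have h := norm_integral_le_of_norm_le (f := fun w => K w z * f w)
    ((integrable_coeFn f).norm.const_mul ((1 - r) ^ (n + 1))⁻¹) (by
      filter_upwards [ae_mem_unitBall n] with w hw
      rw [norm_mul]
      exact mul_le_mul_of_nonneg_right (norm_K_le hr hz hw) (norm_nonneg _))
  rw [integral_const_mul] at h
  exact h.trans (mul_le_mul_of_nonneg_left (integral_norm_le_norm f) (by positivity))

/-- The functional `f ↦ (Pf)(z)` on `Lᵖ`. -/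
def evalCLM (p : ℝ≥0∞) [Fact (1 ≤ p)] {z : Cn n} (hz : z ∈ unitBall n) : LpBall n p →L[ℂ] ℂ :=
  LinearMap.mkContinuous
    { toFun := fun f => projFun f z
      map_add' := fun f g => by
        rw [projFun_congr_ae (Lp.coeFn_add f g),
          projFun_add (integrable_coeFn f) (integrable_coeFn g) hz]
      map_smul' := fun c f => by
        rw [projFun_congr_ae (Lp.coeFn_smul c f), projFun_smul]
        rfl }
    (((1 - ‖z‖) ^ (n + 1))⁻¹) fun f => norm_projFun_le f (sub_pos.1 (one_sub_norm_pos hz)) le_rfl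

theorem evalCLM_apply {z : Cn n} (hz : z ∈ unitBall n) (f : LpBall n p) :
    evalCLM p hz f = projFun f z := rfl

/-- By the reproducing property `projFun` selects the holomorphic representative, which gives point
values of elements of `Aᵖ` a meaning. -/
theorem coe_ae_eq_projFun (g : bergmanSpace n p) :
    (g : LpBall n p) =ᵐ[vol n] projFun (g : LpBall n p) := by
  obtain ⟨h, hd, he⟩ := g.2
  have hi : Integrable h (vol n) := (integrable_coeFn (g : LpBall n p)).congr he
  filter_upwards [he, ae_mem_unitBall n] with z h1 h2
  rw [projFun_congr_ae he, projFun_eq_of_differentiableOn hd hi h2, h1]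

theorem IsBergmanProjection.apply_coe {P : LpBall n p →L[ℂ] bergmanSpace n p}
    (hP : IsBergmanProjection P) (g : bergmanSpace n p) : P g = g :=
  Subtype.ext (Lp.ext ((hP g).trans (coe_ae_eq_projFun g).symm))

theorem IsBergmanProjection.apply_congr {P : LpBall n p →L[ℂ] bergmanSpace n p}
    (hP : IsBergmanProjection P) {f g : LpBall n p}
    (h : ∀ z ∈ unitBall n, projFun f z = projFun g z) : P f = P g := by
  refine Subtype.ext (Lp.ext ?_)
  filter_upwards [hP f, hP g, ae_mem_unitBall n] with z h1 h2 h3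
  rw [h1, h2]
  exact h z h3

/-- The bound for `‖K_w‖` blows up as `w` approaches the sphere; the support condition keeps `w` in
a ball where it is uniform. -/
theorem integrable_smul_kernelLp {f : LpBall n p} {r : ℝ} (hr : r < 1)
    (hf : ∀ᵐ w ∂(vol n), r < ‖w‖ → f w = 0) :
    Integrable (fun w => f w • (kernelLp n p w : LpBall n p)) (vol n) := by
  refine Integrable.mono' ((integrable_coeFn f).norm.mul_const ((1 - r) ^ (n + 1))⁻¹) ?_ ?_
  · refine (Lp.aestronglyMeasurable f).smul (aestronglyMeasurable_vol_of_continuousOn ?_)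
    exact continuous_subtype_val.comp_continuousOn continuousOn_kernelLp
  · filter_upwards [hf] with w hw
    rw [norm_smul]
    rcases le_or_gt ‖w‖ r with h | h
    · exact mul_le_mul_of_nonneg_left (norm_kernelLp_le hr h) (norm_nonneg _)
    · simp [hw h]

/-- The integral representation of `TP` on functions supported in a smaller ball. -/
theorem IsBergmanProjection.projFun_comp_apply {P : LpBall n p →L[ℂ] bergmanSpace n p}
    (hP : IsBergmanProjection P) (T : bergmanSpace n p →L[ℂ] bergmanSpace n p)
    {f : LpBall n p} {r : ℝ} (hr : r < 1) (hf : ∀ᵐ w ∂(vol n), r < ‖w‖ → f w = 0)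
    {z : Cn n} (hz : z ∈ unitBall n) :
    projFun (T (P f) : LpBall n p) z
      = ∫ w, f w * projFun (T (kernelLp n p w) : LpBall n p) z ∂(vol n) := by
  have hi := integrable_smul_kernelLp hr hf
  set J : LpBall n p := ∫ w, f w • (kernelLp n p w : LpBall n p) ∂(vol n) with hJ
  -- The Bochner integral `J` of `f(w) K_w` is taken in `Lᵖ`, and `P` brings it back to `Aᵖ`.
  -- Evaluation at `x` commutes with the integral, so both sides have the same point values.
  have hPJ : P f = P J := by
    refine hP.apply_congr fun x hx => ?_
    rw [← evalCLM_apply hx J, hJ, ← ContinuousLinearMap.integral_comp_comm _ hi]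
    refine integral_congr_ae ?_
    filter_upwards [ae_mem_unitBall n] with w hw
    rw [map_smul, evalCLM_apply, projFun_kernelLp hx hw, smul_eq_mul, mul_comm]
  rw [hPJ]
  have h := ((evalCLM p hz) ∘L (bergmanSpace n p).subtypeL ∘L T ∘L P).integral_comp_comm hi
  refine (Eq.trans ?_ h.symm).trans (integral_congr_ae (Eventually.of_forall fun w => ?_))
  · rfl
  · simp only [map_smul, smul_eq_mul]
    change f w * projFun (T (P (kernelLp n p w)) : LpBall n p) z = _
    rw [hP.apply_coe]

/-- Joint continuity, needed for measurability of the kernel, combines continuity of `w ↦ T K_w` in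
norm with evaluation functionals bounded uniformly near `z₀`. -/
theorem continuousOn_projFun_kernelLp (T : bergmanSpace n p →L[ℂ] bergmanSpace n p) :
    ContinuousOn (fun x : Cn n × Cn n => projFun (T (kernelLp n p x.2) : LpBall n p) x.1)
      (unitBall n ×ˢ unitBall n) := by
  rintro ⟨z₀, w₀⟩ ⟨hz₀, hw₀⟩
  have hg : ContinuousWithinAt (fun x : Cn n × Cn n => (T (kernelLp n p x.2) : LpBall n p))
      (unitBall n ×ˢ unitBall n) (z₀, w₀) := by
    refine (continuous_subtype_val.comp T.continuous).continuousAt.comp_continuousWithinAt ?_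
    exact ContinuousWithinAt.comp (g := kernelLp n p) (f := Prod.snd) (t := unitBall n)
      (x := (z₀, w₀)) (continuousOn_kernelLp w₀ hw₀) continuousWithinAt_snd fun x hx => hx.2
  set g₀ : LpBall n p := (T (kernelLp n p w₀) : LpBall n p) with hg₀
  have hz1 := one_sub_norm_pos hz₀
  set r : ℝ := (1 + ‖z₀‖) / 2 with hr
  have hr1 : r < 1 := by linarith
  have h1 : Tendsto (fun x : Cn n × Cn n => projFun ((T (kernelLp n p x.2) : LpBall n p) - g₀ :
      LpBall n p) x.1) (𝓝[unitBall n ×ˢ unitBall n] (z₀, w₀)) (𝓝 0) := by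
    have h2 : Tendsto (fun x : Cn n × Cn n => ((1 - r) ^ (n + 1))⁻¹ *
        ‖(T (kernelLp n p x.2) : LpBall n p) - g₀‖)
        (𝓝[unitBall n ×ˢ unitBall n] (z₀, w₀)) (𝓝 0) := by
      have h3 := (hg.tendsto.sub_const g₀).norm.const_mul ((1 - r) ^ (n + 1))⁻¹
      simpa [hg₀] using h3
    refine squeeze_zero_norm' ?_ h2
    have h4 : ∀ᶠ x : Cn n × Cn n in 𝓝 (z₀, w₀), ‖x.1‖ < r := by
      have : Tendsto (fun x : Cn n × Cn n => ‖x.1‖) (𝓝 (z₀, w₀)) (𝓝 ‖z₀‖) :=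
        (continuous_fst.norm).tendsto _
      exact this.eventually_lt_const (by linarith)
    filter_upwards [nhdsWithin_le_nhds h4] with x hx
    exact norm_projFun_le _ hr1 hx.le
  have h5 : ContinuousWithinAt (fun x : Cn n × Cn n => projFun g₀ x.1)
      (unitBall n ×ˢ unitBall n) (z₀, w₀) :=
    ContinuousWithinAt.comp (g := projFun g₀) (f := Prod.fst) (t := unitBall n) (x := (z₀, w₀))
      ((differentiableOn_projFun (integrable_coeFn g₀)).continuousOn z₀ hz₀)
      continuousWithinAt_fst fun x hx => hx.1
  have h6 := h1.add h5.tendsto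
  rw [zero_add] at h6
  refine h6.congr' ?_
  filter_upwards [self_mem_nhdsWithin] with x hx
  have h7 := map_sub (evalCLM p hx.1) (T (kernelLp n p x.2) : LpBall n p) g₀
  simp only [evalCLM_apply] at h7
  rw [h7, sub_add_cancel]

end Representation

/-! ### The Bergman metric and the localization integrals -/

theorem rho_comm {n : ℕ} {z w : Cn n} (hz : z ∈ unitBall n) (hw : w ∈ unitBall n) :
    rho z w = rho w z := by
  have h1 := one_sub_norm_sq_moebius hz hw
  have h2 := one_sub_norm_sq_moebius hw hz
  have h3 : ‖(1 - inner ℂ z w : ℂ)‖ = ‖(1 - inner ℂ w z : ℂ)‖ := by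
    rw [← inner_conj_symm w z, ← RCLike.norm_conj]
    simp
  rw [h3, mul_comm, ← h2] at h1
  exact (pow_left_inj₀ (norm_nonneg _) (norm_nonneg _) two_ne_zero).1 (by linarith)

theorem beta_comm {n : ℕ} {z w : Cn n} (hz : z ∈ unitBall n) (hw : w ∈ unitBall n) :
    beta z w = beta w z := by
  rw [beta, beta, rho_comm hz hw]

theorem measurable_beta (n : ℕ) : Measurable fun x : Cn n × Cn n => beta x.1 x.2 := by
  unfold beta rho moebius
  fun_prop

theorem measurableSet_D {n : ℕ} (z : Cn n) (r : ℝ) : MeasurableSet (D z r) :=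
  (measurableSet_unitBall n).inter
    (measurableSet_le ((measurable_beta n).comp measurable_prodMk_left) measurable_const)

/-- All powers of `1 - |·|²` from `k`, `normK` and `invVol` cancel except `δ / q` in `z` and `-δ /
q` in `w`. This turns a bound on `schurInt` into a Schur condition with respect to `dv`. -/
theorem schurInt_eq {n : ℕ} {M : Cn n → Cn n → ℂ} {q δ : ℝ} (hq : 0 < q) {z : Cn n}
    (hz : z ∈ unitBall n) {t : Cn n → ℝ} {E : Set (Cn n)} (hE : MeasurableSet E)
    (hEB : E ⊆ unitBall n) (hM : ∀ w ∈ E, ‖M z w‖ =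
      (1 - ‖z‖ ^ 2) ^ (((n : ℝ) + 1) / 2) * (1 - ‖w‖ ^ 2) ^ (((n : ℝ) + 1) / 2) * t w) :
    schurInt M (expo n q δ) z E = ∫⁻ w in E, ENNReal.ofReal ((1 - ‖z‖ ^ 2) ^ (δ / q)) *
      ENNReal.ofReal (t w * (1 - ‖w‖ ^ 2) ^ (-(δ / q))) ∂(vol n) := by
  have hs := one_sub_norm_sq_pos hz
  have hn : (0 : ℝ) < n + 1 := by positivity
  rw [schurInt, invVol, setLIntegral_withDensity_eq_setLIntegral_mul_non_measurable _ (by fun_prop)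
    _ hE (Eventually.of_forall fun _ => ENNReal.ofReal_lt_top)]
  refine setLIntegral_congr_fun hE fun w hw => ?_
  have hwB := hEB hw
  have hsw := one_sub_norm_sq_pos hwB
  simp only [Pi.mul_apply]
  rw [hM w hw, normK_eq hz, normK_eq hwB, ← ENNReal.ofReal_mul (by positivity),
    ← ENNReal.ofReal_mul (by positivity), ← Real.rpow_mul hs.le, ← Real.rpow_mul hsw.le]
  congr 1
  have e1 : (1 - ‖z‖ ^ 2) ^ (δ / q) = (1 - ‖z‖ ^ 2) ^ (((n : ℝ) + 1) / 2) *
      (1 - ‖z‖ ^ 2) ^ (-(((n : ℝ) + 1) / 2) * expo n q δ) := by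
    rw [← Real.rpow_add hs, expo]
    congr 1
    field_simp
    ring
  have e2 : (1 - ‖w‖ ^ 2) ^ (-(δ / q)) = ((1 - ‖w‖ ^ 2) ^ (n + 1))⁻¹ *
      (1 - ‖w‖ ^ 2) ^ (((n : ℝ) + 1) / 2) *
      ((1 - ‖w‖ ^ 2) ^ (-(((n : ℝ) + 1) / 2) * expo n q δ))⁻¹ := by
    rw [← Real.rpow_natCast _ (n + 1), ← Real.rpow_neg hsw.le, ← Real.rpow_neg hsw.le, ← Real.rpow_add hsw,
      ← Real.rpow_add hsw, expo]
    congr 1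
    push_cast
    field_simp
    ring
  rw [e1, e2]
  ring

theorem lintegral_mul_weight_le_of_schurInt_le {n : ℕ} {M : Cn n → Cn n → ℂ} {q δ : ℝ}
    (hq : 0 < q) {z : Cn n} (hz : z ∈ unitBall n) {t : Cn n → ℝ} (ht : ∀ w, 0 ≤ t w)
    {E : Set (Cn n)} (hE : MeasurableSet E) (hEB : E ⊆ unitBall n) (hM : ∀ w ∈ E, ‖M z w‖ =
      (1 - ‖z‖ ^ 2) ^ (((n : ℝ) + 1) / 2) * (1 - ‖w‖ ^ 2) ^ (((n : ℝ) + 1) / 2) * t w)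
    {C : ℝ≥0∞} (hC : schurInt M (expo n q δ) z E ≤ C) :
    ∫⁻ w in E, ENNReal.ofReal (t w) * ENNReal.ofReal ((1 - ‖w‖ ^ 2) ^ (-(δ / q))) ∂(vol n)
      ≤ C * ENNReal.ofReal ((1 - ‖z‖ ^ 2) ^ (-(δ / q))) := by
  have hs := one_sub_norm_sq_pos hz
  have h1 : ENNReal.ofReal ((1 - ‖z‖ ^ 2) ^ (δ / q)) *
      ENNReal.ofReal ((1 - ‖z‖ ^ 2) ^ (-(δ / q))) = 1 := by
    rw [← ENNReal.ofReal_mul (by positivity), ← Real.rpow_add hs]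
    simp
  rw [schurInt_eq hq hz hE hEB hM, lintegral_const_mul' _ _ ENNReal.ofReal_ne_top] at hC
  refine le_trans (le_of_eq ?_) (mul_le_mul_left hC _)
  rw [mul_right_comm, h1, one_mul]
  refine lintegral_congr fun w => ?_
  rw [ENNReal.ofReal_mul (ht w)]

/-! ### Smallness of the kernel far from the diagonal -/

section Localized

variable {n : ℕ} {p : ℝ≥0∞} [Fact (1 ≤ p)]

theorem norm_entry (T : bergmanSpace n p →L[ℂ] bergmanSpace n p) {z w : Cn n}
    (hz : z ∈ unitBall n) (hw : w ∈ unitBall n) : ‖entry T z w‖ =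
      (1 - ‖z‖ ^ 2) ^ (((n : ℝ) + 1) / 2) * (1 - ‖w‖ ^ 2) ^ (((n : ℝ) + 1) / 2) *
        ‖projFun (T (kernelLp n p z) : LpBall n p) w‖ := by
  have hs := one_sub_norm_sq_pos hz
  have hsw := one_sub_norm_sq_pos hw
  have h1 : ∀ g : LpBall n p, pairing g (k w) =
      (((1 - ‖w‖ ^ 2) ^ (((n : ℝ) + 1) / 2) : ℝ) : ℂ) * projFun g w := fun g => by
    rw [pairing, projFun, ← integral_const_mul]
    refine integral_congr_ae (Eventually.of_forall fun x => ?_)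
    simp only [k, map_mul, Complex.conj_ofReal, K_conj]
    ring
  rw [entry, h1, kernel_eq_smul_kernelLp hz, map_smul, Submodule.coe_smul, ← evalCLM_apply hw,
    map_smul, evalCLM_apply, norm_mul, norm_smul, Complex.norm_real, Complex.norm_real,
    Real.norm_of_nonneg (by positivity), Real.norm_of_nonneg (by positivity)]
  ring

/-- Conjugating the pairing exchanges the two points, so the adjoint condition controls the kernel
in its other variable. -/
theorem norm_adjEntry (T : bergmanSpace n p →L[ℂ] bergmanSpace n p) (z w : Cn n) :
    ‖adjEntry T z w‖ = ‖entry T w z‖ := by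
  rw [adjEntry, entry, pairing, pairing, ← RCLike.norm_conj, ← integral_conj]
  simp only [map_mul, RCLike.conj_conj, mul_comm]

/-- The kernel `|(T K_w)(z)|` of `TP`, cut off to the pairs of points at distance more than `r`. -/
def farKernel (T : bergmanSpace n p →L[ℂ] bergmanSpace n p) (r : ℝ) (z w : Cn n) : ℝ≥0∞ :=
  ({x : Cn n × Cn n | r < beta x.1 x.2} ∩ unitBall n ×ˢ unitBall n).indicator
    (fun x => ‖projFun (T (kernelLp n p x.2) : LpBall n p) x.1‖ₑ) (z, w)

theorem measurable_farKernel (T : bergmanSpace n p →L[ℂ] bergmanSpace n p) (r : ℝ) :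
    Measurable (Function.uncurry (farKernel T r)) := by
  classical
  change Measurable (Set.indicator _ _)
  rw [← Set.indicator_indicator]
  refine Measurable.indicator ?_ (measurableSet_lt measurable_const (measurable_beta n))
  have h := ContinuousOn.measurable_piecewise (continuousOn_projFun_kernelLp T).enorm
    (continuousOn_const (c := (0 : ℝ≥0∞)) (s := (unitBall n ×ˢ unitBall n)ᶜ))
    ((measurableSet_unitBall n).prod (measurableSet_unitBall n))
  change Measurable ((unitBall n ×ˢ unitBall n).piecewise _ 0) at h
  rwa [Set.piecewise_eq_indicator] at h

theorem farKernel_eq_indicator_left (T : bergmanSpace n p →L[ℂ] bergmanSpace n p) (r : ℝ)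
    {z : Cn n} (hz : z ∈ unitBall n) (w : Cn n) : farKernel T r z w =
      (unitBall n \ D z r).indicator
        (fun w => ENNReal.ofReal ‖projFun (T (kernelLp n p w) : LpBall n p) z‖) w := by
  classical
  simp only [farKernel, Set.indicator_apply, ofReal_norm]
  refine if_congr ?_ rfl rfl
  simp only [D, Set.mem_inter_iff, Set.mem_ofPred_eq, Set.mem_prod, Set.mem_sdiff, not_and, not_le]
  tauto

theorem farKernel_eq_indicator_right (T : bergmanSpace n p →L[ℂ] bergmanSpace n p) (r : ℝ)
    {w : Cn n} (hw : w ∈ unitBall n) (z : Cn n) : farKernel T r z w =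
      (unitBall n \ D w r).indicator
        (fun z => ENNReal.ofReal ‖projFun (T (kernelLp n p w) : LpBall n p) z‖) z := by
  classical
  simp only [farKernel, Set.indicator_apply, ofReal_norm]
  refine if_congr ?_ rfl rfl
  simp only [D, Set.mem_inter_iff, Set.mem_ofPred_eq, Set.mem_prod, Set.mem_sdiff, not_and, not_le]
  constructor
  · rintro ⟨h1, h2, -⟩
    exact ⟨h2, fun _ => beta_comm h2 hw ▸ h1⟩
  · rintro ⟨h1, h2⟩
    exact ⟨beta_comm hw h1 ▸ h2 h1, h1, hw⟩

theorem IsWeaklyLocalized.exists_lintegral_farKernel_le (hp : 1 < p) (hp' : p ≠ ⊤)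
    {T : bergmanSpace n p →L[ℂ] bergmanSpace n p} (hT : IsWeaklyLocalized T) {ε : ℝ} (hε : 0 < ε) :
    ∃ r : ℝ, 0 < r ∧ ∀ f : Cn n → ℝ≥0∞, Measurable f →
      ∫⁻ z, (∫⁻ w, farKernel T r z w * f w ∂(vol n)) ^ p.toReal ∂(vol n)
        ≤ ENNReal.ofReal ε ^ p.toReal * ∫⁻ w, f w ^ p.toReal ∂(vol n) := by
  have hpq := holderConjugate_toReal hp hp'
  obtain ⟨δ, -, -, h₁, h₂⟩ := hT.vanishing
  set q := p.toReal.conjExponent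
  have hε' : 0 < ENNReal.ofReal ε := ENNReal.ofReal_pos.2 hε
  obtain ⟨r, ⟨hr₁, hr₂⟩, hr⟩ := (((h₁.eventually_lt_const hε').and
    (h₂.eventually_lt_const hε')).and (eventually_gt_atTop (0 : ℝ))).exists
  refine ⟨r, hr, fun f hf => ?_⟩
  -- Both Schur constants are `ε`, and `p / q + 1 = p`.
  have hpow : ENNReal.ofReal ε ^ (p.toReal / q) * ENNReal.ofReal ε
      = ENNReal.ofReal ε ^ p.toReal := by
    rw [hpq.div_conj_eq_sub_one]
    nth_rw 2 [← ENNReal.rpow_one (ENNReal.ofReal ε)]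
    rw [← ENNReal.rpow_add_of_nonneg _ _ hpq.sub_one_pos.le zero_le_one, sub_add_cancel]
  rw [← hpow]
  have hmeas : ∀ z : Cn n, MeasurableSet (unitBall n \ D z r) := fun z =>
    (measurableSet_unitBall n).diff (measurableSet_D z r)
  -- Integration over `w` in `(T K_w)(z)` is governed by the adjoint entries with exponent `δ / p`,
  -- integration over `z` by the entries of `T` with exponent `δ / q`.
  refine lintegral_rpow_lintegral_mul_le_of_weight (δ := δ) hpq (measurable_farKernel T r) hf
    (fun z hz => ?_) (fun w hw => ?_)
  · refine le_trans (le_of_eq ((lintegral_congr fun w => ?_).trans (lintegral_indicator (hmeas z)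
      fun w => ENNReal.ofReal ‖projFun (T (kernelLp n p w) : LpBall n p) z‖ *
        ENNReal.ofReal ((1 - ‖w‖ ^ 2) ^ (-(δ / p.toReal)))))) ?_
    · rw [farKernel_eq_indicator_left T r hz, Set.indicator_mul_left]
    refine lintegral_mul_weight_le_of_schurInt_le (M := adjEntry T) hpq.pos hz
      (fun _ => norm_nonneg _) (hmeas z) Set.sdiff_subset (fun w hw => ?_) ?_
    · rw [norm_adjEntry, norm_entry T hw.1 hz]
      ring
    · exact (le_iSup₂ (f := fun z (_ : z ∈ unitBall n) =>
        schurInt (adjEntry T) (expo n p.toReal δ) z (unitBall n \ D z r)) z hz).trans hr₂.le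
  · refine le_trans (le_of_eq ((lintegral_congr fun z => ?_).trans (lintegral_indicator (hmeas w)
      fun z => ENNReal.ofReal ‖projFun (T (kernelLp n p w) : LpBall n p) z‖ *
        ENNReal.ofReal ((1 - ‖z‖ ^ 2) ^ (-(δ / q)))))) ?_
    · rw [farKernel_eq_indicator_right T r hw, Set.indicator_mul_left]
    refine lintegral_mul_weight_le_of_schurInt_le (M := entry T) hpq.symm.pos hw
      (fun _ => norm_nonneg _) (hmeas w) Set.sdiff_subset (fun z hz => norm_entry T hw hz.1) ?_
    exact (le_iSup₂ (f := fun z (_ : z ∈ unitBall n) =>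
        schurInt (entry T) (expo n q δ) z (unitBall n \ D z r)) w hw).trans hr₁.le

/-- The shells outside the balls shrink to a null set, and the `p`-integral of `|f|` is absolutely
continuous. This supplies the dense class on which the integral representation holds. -/
theorem tendsto_mulInd_closedBall (hp' : p ≠ ⊤) (f : LpBall n p) :
    Tendsto (fun m : ℕ => mulInd (Metric.closedBall 0 (1 - 1 / ((m : ℝ) + 1)))
      Metric.isClosed_closedBall.measurableSet f) atTop (𝓝 f) := by
  set B : ℕ → Set (Cn n) := fun m => Metric.closedBall 0 (1 - 1 / ((m : ℝ) + 1)) with hB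
  have hBm : ∀ m, MeasurableSet (B m) := fun m => Metric.isClosed_closedBall.measurableSet
  have hanti : Antitone fun m => (B m)ᶜ := by
    intro m m' h
    refine Set.compl_subset_compl.2 (Metric.closedBall_subset_closedBall ?_)
    have := Nat.one_div_le_one_div (α := ℝ) h
    linarith
  have hlim : Tendsto (fun m => vol n (B m)ᶜ) atTop (𝓝 0) := by
    have h := tendsto_measure_iInter_atTop (μ := vol n)
      (fun m => (hBm m).compl.nullMeasurableSet) hanti ⟨0, measure_ne_top _ _⟩
    have h0 : vol n (⋂ m, (B m)ᶜ) = 0 := by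
      refine measure_mono_null (fun z hz => ?_) (ae_mem_unitBall n)
      intro hzB
      simp only [unitBall, Metric.mem_ball, dist_zero_right, Set.mem_ofPred_eq] at hzB
      obtain ⟨m, hm⟩ := exists_nat_one_div_lt (sub_pos.2 hzB)
      refine Set.mem_iInter.1 hz m ?_
      simp only [hB, Metric.mem_closedBall, dist_zero_right]
      linarith
    rwa [h0] at h
  rw [Metric.tendsto_nhds]
  intro ε hε
  obtain ⟨η, hη, h⟩ := (Lp.memLp f).eLpNorm_indicator_le Fact.out hp' (half_pos hε)
  filter_upwards [hlim.eventually_le_const (ENNReal.ofReal_pos.2 hη)] with m hm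
  have h1 := h _ (hBm m).compl hm
  have h2 : (mulInd (B m) (hBm m) f - f : LpBall n p) =ᵐ[vol n] -((B m)ᶜ.indicator f) := by
    filter_upwards [Lp.coeFn_sub (mulInd (B m) (hBm m) f) f, coeFn_mulInd (hBm m) f] with z h3 h4
    rw [h3, Pi.sub_apply, h4, Pi.neg_apply]
    by_cases hz : z ∈ B m <;> simp [hz]
  rw [dist_eq_norm, Lp.norm_def, eLpNorm_congr_ae h2, eLpNorm_neg]
  exact (ENNReal.toReal_le_of_le_ofReal (half_pos hε).le h1).trans_lt (half_lt_self hε)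

theorem IsBergmanProjection.enorm_comp_apply_le {P : LpBall n p →L[ℂ] bergmanSpace n p}
    (hP : IsBergmanProjection P) (T : bergmanSpace n p →L[ℂ] bergmanSpace n p)
    {f : LpBall n p} {r : ℝ} (hr : r < 1) (hf : ∀ᵐ w ∂(vol n), r < ‖w‖ → f w = 0) :
    ∀ᵐ z ∂(vol n), ‖(T (P f) : LpBall n p) z‖ₑ
      ≤ ∫⁻ w, ‖projFun (T (kernelLp n p w) : LpBall n p) z‖ₑ * ‖f w‖ₑ ∂(vol n) := by
  filter_upwards [coe_ae_eq_projFun (T (P f)), ae_mem_unitBall n] with z h1 h2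
  rw [h1, hP.projFun_comp_apply T hr hf h2]
  refine (enorm_integral_le_lintegral_enorm _).trans (le_of_eq (lintegral_congr fun w => ?_))
  rw [enorm_mul, mul_comm]

theorem lt_beta_of_notMem_nhd {r : ℝ} {F : Set (Cn n)} {z w : Cn n} (hz : z ∈ F)
    (hw : w ∈ unitBall n) (h : w ∉ nhd r F) : r < beta z w := by
  by_contra hle
  refine h ⟨hw, (iInf₂_le z hz).trans ?_⟩
  exact ENNReal.ofReal_le_ofReal (not_lt.1 hle)

/-! ### The error of the block sum -/

section Covering

variable {P : LpBall n p →L[ℂ] bergmanSpace n p} {T : bergmanSpace n p →L[ℂ] bergmanSpace n p}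
  {N : ℕ} {r : ℝ} {F : ℕ → Set (Cn n)} {S : LpBall n p →L[ℂ] LpBall n p}

theorem mulInd_hasSum_eq {A : LpBall n p →L[ℂ] LpBall n p} {G : ℕ → Set (Cn n)}
    (hF : ∀ j, MeasurableSet (F j)) (hd : Pairwise fun i j => Disjoint (F i) (F j))
    (hG : ∀ j, MeasurableSet (G j)) {f g : LpBall n p}
    (hS : HasSum (fun j => mulInd (F j) (hF j) (A (mulInd (G j) (hG j) f))) g) (j : ℕ) :
    mulInd (F j) (hF j) g = mulInd (F j) (hF j) (A (mulInd (G j) (hG j) f)) := by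
  have h1 := hS.mapL (mulInd (F j) (hF j))
  have h2 := hasSum_single j fun i (hi : i ≠ j) =>
    mulInd_mulInd_of_disjoint (hF j) (hF i) (hd hi.symm) (A (mulInd (G i) (hG i) f))
  rw [h1.unique h2, mulInd_mulInd_self]

/-- For `z ∈ F j` the difference is `TP` of `f' j`, which is `f` outside `G j` and zero on it. There
`β(z, w) > r`, so the cutoff kernel dominates, and the resulting bound no longer depends on `j`. -/
theorem IsBorelCovering.enorm_sub_le_farKernel (hF : IsBorelCovering n N r F)
    (hP : IsBergmanProjection P)
    (hS : ∀ f, HasSum (fun j => mulInd (F j) (hF.measurable j) (T (P (mulInd (nhd r (F j))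
      (measurableSet_nhd r (hF.subset j)) f)) : LpBall n p)) (S f))
    {f : LpBall n p} {s : ℝ} (hs : s < 1) (hf : ∀ᵐ w ∂(vol n), s < ‖w‖ → f w = 0) :
    ∀ᵐ z ∂(vol n), ‖((T (P f) : LpBall n p) - S f : LpBall n p) z‖ₑ
      ≤ ∫⁻ w, farKernel T r z w * ‖f w‖ₑ ∂(vol n) := by
  have hG := fun j => measurableSet_nhd r (hF.subset j)
  set f' : ℕ → LpBall n p := fun j => f - mulInd (nhd r (F j)) (hG j) f with hf'
  have hf'c : ∀ j, (f' j : LpBall n p) =ᵐ[vol n] (nhd r (F j))ᶜ.indicator f := fun j => by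
    filter_upwards [Lp.coeFn_sub f (mulInd (nhd r (F j)) (hG j) f), coeFn_mulInd (hG j) f]
      with z h1 h2
    rw [h1, Pi.sub_apply, h2]
    by_cases hz : z ∈ nhd r (F j) <;> simp [hz]
  have hf's : ∀ j, ∀ᵐ w ∂(vol n), s < ‖w‖ → f' j w = 0 := fun j => by
    filter_upwards [hf'c j, hf] with w h1 h2 h3
    rw [h1]
    by_cases hw : w ∈ (nhd r (F j))ᶜ
    · rw [Set.indicator_of_mem hw, h2 h3]
    · exact Set.indicator_of_notMem hw _
  have hloc : ∀ j, mulInd (F j) (hF.measurable j) ((T (P f) : LpBall n p) - S f)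
      = mulInd (F j) (hF.measurable j) (T (P (f' j)) : LpBall n p) := fun j => by
    have h1 := mulInd_hasSum_eq (A := (bergmanSpace n p).subtypeL ∘L T ∘L P) hF.measurable
      hF.disjoint hG (hS f) j
    rw [map_sub, h1, ← map_sub]
    congr 1
    simp only [hf', map_sub, Submodule.coe_sub]
    rfl
  have h1 : ∀ᵐ z ∂(vol n), ∀ j, ‖(T (P (f' j)) : LpBall n p) z‖ₑ
      ≤ ∫⁻ w, ‖projFun (T (kernelLp n p w) : LpBall n p) z‖ₑ * ‖f' j w‖ₑ ∂(vol n) :=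
    ae_all_iff.2 fun j => hP.enorm_comp_apply_le T hs (hf's j)
  have h2 : ∀ᵐ z ∂(vol n), ∀ j, (F j).indicator ((T (P f) : LpBall n p) - S f : LpBall n p) z
      = (F j).indicator (T (P (f' j)) : LpBall n p) z := ae_all_iff.2 fun j => by
    filter_upwards [coeFn_mulInd (hF.measurable j) ((T (P f) : LpBall n p) - S f),
      coeFn_mulInd (hF.measurable j) (T (P (f' j)) : LpBall n p)] with z h3 h4
    rw [← h3, ← h4, hloc j]
  filter_upwards [h1, h2, ae_mem_unitBall n] with z h1z h2z hz
  obtain ⟨j, hj⟩ := Set.mem_iUnion.1 (hF.cover.symm ▸ hz : z ∈ ⋃ j, F j)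
  have h3 := h2z j
  rw [Set.indicator_of_mem hj, Set.indicator_of_mem hj] at h3
  rw [h3]
  refine (h1z j).trans (lintegral_mono_ae ?_)
  filter_upwards [hf'c j, ae_mem_unitBall n] with w h4 hw
  rw [h4]
  by_cases hwG : w ∈ nhd r (F j)
  · simp [hwG]
  · rw [Set.indicator_of_mem (Set.mem_compl hwG), farKernel, Set.indicator_of_mem]
    exact ⟨lt_beta_of_notMem_nhd hj hw hwG, hz, hw⟩

theorem IsBorelCovering.norm_sub_le (hp' : p ≠ ⊤) (hF : IsBorelCovering n N r F)
    (hP : IsBergmanProjection P)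
    (hS : ∀ f, HasSum (fun j => mulInd (F j) (hF.measurable j) (T (P (mulInd (nhd r (F j))
      (measurableSet_nhd r (hF.subset j)) f)) : LpBall n p)) (S f)) {ε : ℝ} (hε : 0 ≤ ε)
    (hR : ∀ f : Cn n → ℝ≥0∞, Measurable f →
      ∫⁻ z, (∫⁻ w, farKernel T r z w * f w ∂(vol n)) ^ p.toReal ∂(vol n)
        ≤ ENNReal.ofReal ε ^ p.toReal * ∫⁻ w, f w ^ p.toReal ∂(vol n))
    (f : LpBall n p) : ‖(T (P f) : LpBall n p) - S f‖ ≤ ε * ‖f‖ := by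
  have hp0 := toReal_pos_of_fact hp'
  have hcont : Continuous fun f : LpBall n p => (T (P f) : LpBall n p) - S f :=
    (continuous_subtype_val.comp (T.continuous.comp P.continuous)).sub S.continuous
  have hlim := tendsto_mulInd_closedBall hp' f
  -- Both sides are continuous in `f`, so `f` may be replaced by its truncations to closed balls of
  -- radius less than one.
  refine le_of_tendsto_of_tendsto ((hcont.norm.tendsto f).comp hlim) (hlim.norm.const_mul ε)
    (Eventually.of_forall fun m => ?_)
  set g : LpBall n p := mulInd (Metric.closedBall 0 (1 - 1 / ((m : ℝ) + 1)))
      Metric.isClosed_closedBall.measurableSet f with hg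
  have hgs : ∀ᵐ w ∂(vol n), 1 - 1 / ((m : ℝ) + 1) < ‖w‖ → g w = 0 := by
    filter_upwards [coeFn_mulInd (Metric.isClosed_closedBall.measurableSet :
      MeasurableSet (Metric.closedBall (0 : Cn n) (1 - 1 / ((m : ℝ) + 1)))) f] with w h1 h2
    rw [hg, h1, Set.indicator_of_notMem]
    simpa using h2
  have h1 := hF.enorm_sub_le_farKernel hP hS (sub_lt_self 1 (by positivity)) hgs
  have h2 : ‖(T (P g) : LpBall n p) - S g‖ₑ ^ p.toReal ≤ (ENNReal.ofReal ε * ‖g‖ₑ) ^ p.toReal := by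
    rw [ENNReal.mul_rpow_of_nonneg _ _ hp0.le, enorm_rpow_eq_lintegral hp',
      enorm_rpow_eq_lintegral hp']
    refine le_trans (lintegral_mono_ae ?_) (hR _ (Lp.stronglyMeasurable g).enorm)
    filter_upwards [h1] with z hz
    exact ENNReal.rpow_le_rpow hz hp0.le
  have h3 := (ENNReal.rpow_le_rpow_iff hp0).1 h2
  have h4 := ENNReal.toReal_mono (by finiteness) h3
  rwa [ENNReal.toReal_mul, toReal_enorm, toReal_enorm, ENNReal.toReal_ofReal hε] at h4

end Covering
end Localized

theorem norm_subtypeL_comp_sub_le {n : ℕ} {p : ℝ≥0∞} [Fact (1 ≤ p)]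
    (P : LpBall n p →L[ℂ] bergmanSpace n p) (T T' : bergmanSpace n p →L[ℂ] bergmanSpace n p) :
    ‖(bergmanSpace n p).subtypeL ∘L T ∘L P - (bergmanSpace n p).subtypeL ∘L T' ∘L P‖
      ≤ ‖T - T'‖ * ‖P‖ := by
  refine ContinuousLinearMap.opNorm_le_bound _ (by positivity) fun f => ?_
  calc _ = ‖(T - T') (P f)‖ := rfl
    _ ≤ ‖T - T'‖ * ‖P f‖ := (T - T').le_opNorm _
    _ ≤ ‖T - T'‖ * (‖P‖ * ‖f‖) := mul_le_mul_of_nonneg_left (P.le_opNorm f) (norm_nonneg (T - T'))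
    _ = _ := (mul_assoc _ _ _).symm

end Bergman

end

theorem proposition2p5 (n : ℕ) (hn : 1 ≤ n) (p : ℝ≥0∞) [Fact (1 ≤ p)] (hp : 1 < p) (hp' : p ≠ ⊤) :
    ∃ P : Bergman.LpBall n p →L[ℂ] Bergman.bergmanSpace n p,
      Bergman.IsBergmanProjection P ∧
      ∀ T ∈ closure (Bergman.weaklyLocalized n p), ∀ N : ℕ, ∀ ε : ℝ, 0 < ε →
        ∃ r : ℝ, 0 < r ∧
          ∀ (F : ℕ → Set (Bergman.Cn n)) (hF : Bergman.IsBorelCovering n N r F),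
            ∃ S : Bergman.bergmanSpace n p →L[ℂ] Bergman.LpBall n p,
              (∀ f : Bergman.bergmanSpace n p,
                HasSum (fun j : ℕ =>
                  Bergman.mulInd (F j) (hF.measurable j)
                    (T (P (Bergman.mulInd (Bergman.nhd r (F j))
                      (Bergman.measurableSet_nhd r (hF.subset j)) f)))) (S f)) ∧
              ‖(Bergman.bergmanSpace n p).subtypeL ∘L T ∘L P ∘L (Bergman.bergmanSpace n p).subtypeL
                  - S‖ < ε := by
  obtain ⟨P, hP⟩ := Bergman.exists_isBergmanProjection hn hp hp'
  refine ⟨P, hP, fun T hT N ε hε => ?_⟩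
  set c : ℝ := (N : ℝ) ^ (1 / p.toReal) with hc
  have hc0 : 0 ≤ c := by positivity
  -- Exchanging `T` for `T'` costs `‖T - T'‖ ‖P‖` in `TP` and `c` times that in the block sum. The
  -- summand `1` keeps the denominator positive even if `P = 0`.
  have hM : 0 < (1 + c) * ‖P‖ + 1 := by positivity
  obtain ⟨T', hT', hd⟩ := (Metric.mem_closure_iff
    (α := Bergman.bergmanSpace n p →L[ℂ] Bergman.bergmanSpace n p)).1 hT (ε / 2 / ((1 + c) * ‖P‖ + 1)) (by positivity)
  replace hd := (dist_eq_norm T T').symm.trans_lt hd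
  rw [lt_div_iff₀ hM] at hd
  -- The radius depends only on `T'` and `ε`, and is fixed before any covering is given.
  obtain ⟨r, hr, hR⟩ := Bergman.IsWeaklyLocalized.exists_lintegral_farKernel_le hp hp' hT'
    (ε := ε / 4) (by positivity)
  refine ⟨r, hr, fun F hF => ?_⟩
  have hG := fun j => Bergman.measurableSet_nhd r (hF.subset j)
  set A := (Bergman.bergmanSpace n p).subtypeL ∘L T ∘L P with hA
  set A' := (Bergman.bergmanSpace n p).subtypeL ∘L T' ∘L P with hA'
  obtain ⟨S, hS, -⟩ := Bergman.exists_hasSum_mulInd_comp hp' hF.measurable hF.disjoint hG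
    hF.multiplicity A
  obtain ⟨S', hS', -⟩ := Bergman.exists_hasSum_mulInd_comp hp' hF.measurable hF.disjoint hG
    hF.multiplicity A'
  obtain ⟨Q, hQ, hQn⟩ := Bergman.exists_hasSum_mulInd_comp hp' hF.measurable hF.disjoint hG
    hF.multiplicity (A - A')
  have hAA' : ‖A - A'‖ ≤ ‖T - T'‖ * ‖P‖ := Bergman.norm_subtypeL_comp_sub_le P T T'
  have hSQ : ∀ f, S f - S' f = Q f := fun f => by
    refine ((hS f).sub (hS' f)).unique ?_
    simpa only [sub_apply, map_sub] using hQ f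
  refine ⟨S ∘L (Bergman.bergmanSpace n p).subtypeL, fun f => hS f, ?_⟩
  refine lt_of_le_of_lt (ContinuousLinearMap.opNorm_le_bound _ (M := 3 * ε / 4) (by positivity)
    fun f => ?_) (by linarith)
  have h1 := hF.norm_sub_le hp' hP hS' (by positivity) hR (f : Bergman.LpBall n p)
  have h2 : ‖(A - A') f‖ ≤ ‖T - T'‖ * ‖P‖ * ‖f‖ :=
    ((A - A').le_opNorm _).trans (mul_le_mul_of_nonneg_right hAA' (norm_nonneg _))
  have h3 : ‖Q f‖ ≤ c * (‖T - T'‖ * ‖P‖) * ‖f‖ := (Q.le_opNorm _).trans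
    (mul_le_mul_of_nonneg_right (hQn.trans (mul_le_mul_of_nonneg_left hAA' hc0)) (norm_nonneg _))
  -- A three-term comparison through `T'`: the change in `TP`, the localized error of `T'`, and the
  -- block sum `Q` of the difference.
  have h4 : A f - S f = (A - A') f + ((T' (P f) : Bergman.LpBall n p) - S' f) - Q f := by
    rw [← hSQ, sub_apply]
    change A f - S f = A f - A' f + (A' f - S' f) - (S f - S' f)
    abel
  calc _ = ‖A f - S f‖ := rfl
    _ ≤ ‖(A - A') f‖ + ‖(T' (P f) : Bergman.LpBall n p) - S' f‖ + ‖Q f‖ := by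
        rw [h4]
        exact (norm_sub_le _ _).trans (add_le_add (norm_add_le _ _) le_rfl)
    _ ≤ ‖T - T'‖ * ‖P‖ * ‖f‖ + ε / 4 * ‖f‖ + c * (‖T - T'‖ * ‖P‖) * ‖f‖ :=
        add_le_add (add_le_add h2 h1) h3
    _ = (‖T - T'‖ * ((1 + c) * ‖P‖) + ε / 4) * ‖f‖ := by ring
    _ ≤ 3 * ε / 4 * ‖f‖ := by
        refine mul_le_mul_of_nonneg_right ?_ (norm_nonneg _)
        -- The two exchange terms together stay below `ε / 2` by the choice of `T'`, and the
        -- localized error adds `ε / 4`.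
        nlinarith [norm_nonneg (T - T')]
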